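/- Let $\mathfrak S$ be the complex Lie algebra with basis $e,h,f,p,q,z$ and brackets $$[h,e]=2e,\quad [h,f]=-2f,\quad [e,f]=h,\quad [h,p]=p,\quad [h,q]=-q,\quad [p,q]=z,$$ $$[e,q]=p,\quad [p,f]=-q,\quad [f,q]=0,\quad [e,p]=0,\quad [z,\mathfrak S]=0$$ (the Schrödinger algebra), and put $\mathfrak n^+=\mathrm{span}\{p,e\}$, $\mathfrak H=\mathrm{span}\{p,q,z\}$, $sl_2=\mathrm{span}\{e,h,f\}$. For a Lie algebra $L$, a subalgebra $\mathfrak n$ and a Lie algebra homomorphism $\phi:\mathfrak n\to\mathbb C$, a Whittaker $L$-module of type $\phi$ is an $L$-module generated by a nonzero vector $v$ with $xv=\phi(x)v$ for all $x\in\mathfrak n$. For $\mathfrak S$ we take $\mathfrak n=\mathfrak n^+$, for $sl_2$ we take $\mathfrak n=\mathbb Ce$, and for $\mathfrak H$ we take $\mathfrak n=\mathbb Cp\oplus\mathbb Cz$. For $\dot p,\dot z\in\mathbb C$ let $M_{\mathfrak H}(\dot p,\dot z)=U(\mathfrak H)\otimes_{U(\mathbb Cp\oplus\mathbb Cz)}\mathbb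 C_{\dot p,\dot z}$, where $p,z$ act on $\mathbb C_{\dot p,\dot z}$ by $\dot p,\dot z$. Let $U(\mathfrak H)_{(z)}$ be the localization of $U(\mathfrak H)$ at the powers of $z$, and let $\Phi:U(\mathfrak S)\to U(\mathfrak H)_{(z)}$ be the algebra homomorphism that is the identity on $U(\mathfrak H)$ and satisfies $$\Phi(e)=\tfrac1{2z}p^2,\qquad \Phi(f)=-\tfrac1{2z}q^2,\qquad \Phi(h)=-\tfrac1z qp-\tfrac12 .$$ If $\dot z\ne0$, then $z$ acts invertibly on $M_{\mathfrak H}(\dot p,\dot z)$, and $M_{\mathfrak H}^{\mathfrak S}(\dot p,\dot z)$ denotes this space as an $\mathfrak S$-module through $\Phi$. For an $sl_2$-module $M$, let $M^{\mathfrak S}$ be the $\mathfrak S$-module obtained by letting $\mathfrak H$ act by zero. Let $\Omega=4fe+2h+h^2\in U(sl_2)$. For $a,\dot\Omega\in\mathbb C$ let $M_{sl_2}(a,\dot\Omega)$ be the quotient of $U(sl_2)\otimes_{U(\mathbb Ce)}\mathbb Cw$, $ew=aw$, by its submodule generated by $(\Omega-\dot\Omega)w$. **Theorem 4.10.** Let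 $W$ be a Whittaker $\mathfrak S$-module of type $\phi:\ e\mapsto\dot e,\ p\mapsto\dot p$ on which $z$ acts as a scalar $\dot z\neq0$, and put $a=\dot e-\frac{1}{2\dot z}\dot p^2$. Then: 1. $M_{\mathfrak H}(\dot p,\dot z)$ is a simple Whittaker $\mathfrak H$-module of type $p\mapsto\dot p$, $z\mapsto\dot z$. 2. $W$ is simple if and only if there exist $\dot\Omega\in\mathbb C$ and a simple Whittaker $sl_2$-module $M$ of type $e\mapsto a$, on which $\Omega$ acts as the scalar $\dot\Omega$, such that $W\cong M_{\mathfrak H}^{\mathfrak S}(\dot p,\dot z)\otimes M^{\mathfrak S}$ as $\mathfrak S$-modules. 3. If $a\neq0$, then $M_{sl_2}(a,\dot\Omega)$ is a simple Whittaker $sl_2$-module of type $e\mapsto a$ for every $\dot\Omega\in\mathbb C$, and $W$ is simple if and only if $W\cong M_{\mathfrak H}^{\mathfrak S}(\dot p,\dot z)\otimes M_{sl_2}(a,\dot\Omega)^{\mathfrak S}$ for some $\dot\Omega\in\mathbb C$. -/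

import Mathlib

universe u

open scoped TensorProduct

attribute [local instance 100] LieRing.ofAssociativeRing

/-! ## Modules over the universal enveloping algebra, Whittaker modules -/

section General

variable {L : Type*} [LieRing L] [LieAlgebra ℂ L]

/-- The action of `U(L)` on an `L`-module `V`. -/
noncomputable def uAct (L : Type*) [LieRing L] [LieAlgebra ℂ L] (V : Type*) [AddCommGroup V]
    [Module ℂ V] [LieRingModule L V] [LieModule ℂ L V] :
    UniversalEnvelopingAlgebra ℂ L →ₐ[ℂ] Module.End ℂ V :=
  UniversalEnvelopingAlgebra.lift ℂ (LieModule.toEnd ℂ L V)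

/-- A Whittaker vector of type `φ : n → ℂ`: a nonzero `v` with `x v = φ(x) v` for all `x ∈ n`. -/
def IsWhittakerVector (n : LieSubalgebra ℂ L) (φ : LieAlgebra.LieCharacter ℂ n) {V : Type*}
    [AddCommGroup V] [Module ℂ V] [LieRingModule L V] (v : V) : Prop :=
  v ≠ 0 ∧ ∀ x : n, ⁅(x : L), v⁆ = φ x • v

/-- A Whittaker module of type `φ`: an `L`-module with a cyclic Whittaker vector of type `φ`. -/
def IsWhittakerModule (n : LieSubalgebra ℂ L) (φ : LieAlgebra.LieCharacter ℂ n) (V : Type*)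
    [AddCommGroup V] [Module ℂ V] [LieRingModule L V] : Prop :=
  ∃ v : V, IsWhittakerVector n φ v ∧ LieSubmodule.lieSpan ℂ L {v} = ⊤

/-- The left ideal of `U(L)` generated by the elements `x - φ(x)`, `x ∈ n`. -/
noncomputable def whittakerIdeal (n : LieSubalgebra ℂ L) (φ : LieAlgebra.LieCharacter ℂ n) :
    Submodule (UniversalEnvelopingAlgebra ℂ L) (UniversalEnvelopingAlgebra ℂ L) :=
  Submodule.span _ (Set.range fun x : n =>
    UniversalEnvelopingAlgebra.ι ℂ (x : L) - algebraMap ℂ _ (φ x))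

/-- The induced module `U(L) ⊗_{U(n)} ℂ_φ`. As `ℂ_φ = ℂ w` is one-dimensional with
`x w = φ(x) w`, it is the quotient of `U(L)` (with `u` standing for `u ⊗ w`) by the left ideal
generated by the relations `u x ⊗ w = u ⊗ x w`, `x ∈ n`. -/
def InducedModule (n : LieSubalgebra ℂ L) (φ : LieAlgebra.LieCharacter ℂ n) : Type _ :=
  UniversalEnvelopingAlgebra ℂ L ⧸ whittakerIdeal n φ

namespace InducedModule

variable (n : LieSubalgebra ℂ L) (φ : LieAlgebra.LieCharacter ℂ n)

noncomputable instance : AddCommGroup (InducedModule n φ) :=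
  inferInstanceAs (AddCommGroup (UniversalEnvelopingAlgebra ℂ L ⧸ whittakerIdeal n φ))

noncomputable instance : Module (UniversalEnvelopingAlgebra ℂ L) (InducedModule n φ) :=
  inferInstanceAs (Module (UniversalEnvelopingAlgebra ℂ L)
    (UniversalEnvelopingAlgebra ℂ L ⧸ whittakerIdeal n φ))

noncomputable instance : Module ℂ (InducedModule n φ) :=
  inferInstanceAs (Module ℂ (UniversalEnvelopingAlgebra ℂ L ⧸ whittakerIdeal n φ))

instance : IsScalarTower ℂ (UniversalEnvelopingAlgebra ℂ L) (InducedModule n φ) :=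
  inferInstanceAs (IsScalarTower ℂ (UniversalEnvelopingAlgebra ℂ L)
    (UniversalEnvelopingAlgebra ℂ L ⧸ whittakerIdeal n φ))

/-- `L` acts through left multiplication in `U(L)`. -/
noncomputable instance : LieRingModule L (InducedModule n φ) where
  bracket x v := UniversalEnvelopingAlgebra.ι ℂ x • v
  add_lie x y v := by
    rw [map_add, add_smul]
  lie_add _ v w := smul_add _ v w
  leibniz_lie x y v := by
    change UniversalEnvelopingAlgebra.ι ℂ x • UniversalEnvelopingAlgebra.ι ℂ y • v =
      UniversalEnvelopingAlgebra.ι ℂ ⁅x, y⁆ • v +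
        UniversalEnvelopingAlgebra.ι ℂ y • UniversalEnvelopingAlgebra.ι ℂ x • v
    rw [LieHom.map_lie, LieRing.of_associative_ring_bracket, sub_smul, mul_smul, mul_smul,
      sub_add_cancel]

theorem lie_eq_smul (x : L) (v : InducedModule n φ) :
    ⁅x, v⁆ = UniversalEnvelopingAlgebra.ι ℂ x • v := rfl

noncomputable instance : LieModule ℂ L (InducedModule n φ) where
  smul_lie t x v := by
    rw [lie_eq_smul, lie_eq_smul, map_smul, smul_assoc]
  lie_smul t x v := by
    rw [lie_eq_smul, lie_eq_smul, ← algebraMap_smul (UniversalEnvelopingAlgebra ℂ L) t v,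
      ← algebraMap_smul (UniversalEnvelopingAlgebra ℂ L) t (_ • v), smul_smul, smul_smul,
      Algebra.commutes]

/-- The generator `w = 1 ⊗ w` of the induced module. -/
noncomputable def gen : InducedModule n φ :=
  Submodule.Quotient.mk (p := whittakerIdeal n φ) (1 : UniversalEnvelopingAlgebra ℂ L)

theorem smul_gen_eq_mk (u : UniversalEnvelopingAlgebra ℂ L) :
    u • gen n φ = Submodule.Quotient.mk (p := whittakerIdeal n φ) u :=
  congrArg (Submodule.Quotient.mk (p := whittakerIdeal n φ)) (mul_one u)

theorem exists_smul_gen (v : InducedModule n φ) :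
    ∃ u : UniversalEnvelopingAlgebra ℂ L, u • gen n φ = v := by
  obtain ⟨u, hu⟩ := Submodule.Quotient.mk_surjective (whittakerIdeal n φ) v
  exact ⟨u, (smul_gen_eq_mk n φ u).trans hu⟩

theorem lie_gen (x : n) : ⁅(x : L), gen n φ⁆ = φ x • gen n φ := by
  rw [lie_eq_smul, ← sub_eq_zero, ← algebraMap_smul (UniversalEnvelopingAlgebra ℂ L) (φ x),
    ← sub_smul, smul_gen_eq_mk]
  exact (Submodule.Quotient.mk_eq_zero _).2 (Submodule.subset_span ⟨x, rfl⟩)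

end InducedModule

end General

/-! ## The Schrödinger algebra -/

/-- The Schrödinger algebra `𝔖`: the coordinates `x 0, …, x 5` are those with respect to the basis
`e, h, f, p, q, z`, in this order. -/
def Schrodinger : Type := Fin 6 → ℂ

namespace Schrodinger

noncomputable instance : AddCommGroup Schrodinger := inferInstanceAs (AddCommGroup (Fin 6 → ℂ))

noncomputable instance : Module ℂ Schrodinger := inferInstanceAs (Module ℂ (Fin 6 → ℂ))

@[simp] theorem add_apply (x y : Schrodinger) (i : Fin 6) : (x + y) i = x i + y i := rfl

@[simp] theorem smul_apply (t : ℂ) (x : Schrodinger) (i : Fin 6) : (t • x) i = t * x i := rfl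

@[simp] theorem zero_apply (i : Fin 6) : (0 : Schrodinger) i = 0 := rfl

@[simp] theorem neg_apply (x : Schrodinger) (i : Fin 6) : (-x) i = -x i := rfl

/-- The element of `𝔖` with given coordinates. -/
def mk (v : Fin 6 → ℂ) : Schrodinger := v

@[simp] theorem mk_apply (v : Fin 6 → ℂ) (i : Fin 6) : mk v i = v i := rfl

noncomputable instance : Bracket Schrodinger Schrodinger where
  bracket x y := mk
    ![2 * (x 1 * y 0 - x 0 * y 1),
      x 0 * y 2 - x 2 * y 0,
      -2 * (x 1 * y 2 - x 2 * y 1),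
      (x 1 * y 3 - x 3 * y 1) + (x 0 * y 4 - x 4 * y 0),
      -(x 1 * y 4 - x 4 * y 1) - (x 3 * y 2 - x 2 * y 3),
      x 3 * y 4 - x 4 * y 3]

@[simp] theorem lie_apply_zero (x y : Schrodinger) :
    ⁅x, y⁆ 0 = 2 * (x 1 * y 0 - x 0 * y 1) := rfl

@[simp] theorem lie_apply_one (x y : Schrodinger) : ⁅x, y⁆ 1 = x 0 * y 2 - x 2 * y 0 := rfl

@[simp] theorem lie_apply_two (x y : Schrodinger) :
    ⁅x, y⁆ 2 = -2 * (x 1 * y 2 - x 2 * y 1) := rfl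

@[simp] theorem lie_apply_three (x y : Schrodinger) :
    ⁅x, y⁆ 3 = (x 1 * y 3 - x 3 * y 1) + (x 0 * y 4 - x 4 * y 0) := rfl

@[simp] theorem lie_apply_four (x y : Schrodinger) :
    ⁅x, y⁆ 4 = -(x 1 * y 4 - x 4 * y 1) - (x 3 * y 2 - x 2 * y 3) := rfl

@[simp] theorem lie_apply_five (x y : Schrodinger) : ⁅x, y⁆ 5 = x 3 * y 4 - x 4 * y 3 := rfl

/-- To compare two elements of `𝔖`, compare the six coordinates. -/
theorem ext6 {x y : Schrodinger} (h0 : x 0 = y 0) (h1 : x 1 = y 1) (h2 : x 2 = y 2)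
    (h3 : x 3 = y 3) (h4 : x 4 = y 4) (h5 : x 5 = y 5) : x = y := by
  funext i; fin_cases i <;> assumption

noncomputable instance : LieRing Schrodinger where
  add_lie x y t := by
    apply ext6 <;> simp <;> ring
  lie_add x y t := by
    apply ext6 <;> simp <;> ring
  lie_self x := by
    apply ext6 <;> simp <;> ring
  leibniz_lie x y t := by
    apply ext6 <;> simp <;> ring

noncomputable instance : LieAlgebra ℂ Schrodinger where
  lie_smul t x y := by
    apply ext6 <;> simp <;> ring

/-- The basis vector `e`. -/
noncomputable def e : Schrodinger := mk ![1, 0, 0, 0, 0, 0]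
/-- The basis vector `h`. -/
noncomputable def h : Schrodinger := mk ![0, 1, 0, 0, 0, 0]
/-- The basis vector `f`. -/
noncomputable def f : Schrodinger := mk ![0, 0, 1, 0, 0, 0]
/-- The basis vector `p`. -/
noncomputable def p : Schrodinger := mk ![0, 0, 0, 1, 0, 0]
/-- The basis vector `q`. -/
noncomputable def q : Schrodinger := mk ![0, 0, 0, 0, 1, 0]
/-- The basis vector `z`. -/
noncomputable def z : Schrodinger := mk ![0, 0, 0, 0, 0, 1]

/-- The defining relations. -/
theorem relations :
    ⁅h, e⁆ = (2 : ℂ) • e ∧ ⁅h, f⁆ = (-2 : ℂ) • f ∧ ⁅e, f⁆ = h ∧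
    ⁅h, p⁆ = p ∧ ⁅h, q⁆ = -q ∧ ⁅p, q⁆ = z ∧
    ⁅e, q⁆ = p ∧ ⁅p, f⁆ = -q ∧ ⁅f, q⁆ = 0 ∧
    ⁅e, p⁆ = 0 ∧ ∀ x : Schrodinger, ⁅z, x⁆ = 0 := by
  refine ⟨?_, ?_, ?_, ?_, ?_, ?_, ?_, ?_, ?_, ?_, fun x => ?_⟩ <;> apply ext6 <;>
    simp [e, h, f, p, q, z]

/-- The subalgebra `𝔫⁺ = span {p, e}`. -/
noncomputable def nPlus : LieSubalgebra ℂ Schrodinger where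
  carrier := {x | x 1 = 0 ∧ x 2 = 0 ∧ x 4 = 0 ∧ x 5 = 0}
  add_mem' := by
    rintro x y ⟨h1, h2, h3, h4⟩ ⟨k1, k2, k3, k4⟩
    simp [h1, h2, h3, h4, k1, k2, k3, k4]
  zero_mem' := by simp
  smul_mem' := by
    rintro t x ⟨h1, h2, h3, h4⟩
    simp [h1, h2, h3, h4]
  lie_mem' := by
    rintro x y ⟨h1, h2, h3, h4⟩ ⟨k1, k2, k3, k4⟩
    simp [h1, h2, h3, k1, k2, k3]

@[simp] theorem mem_nPlus {x : Schrodinger} : x ∈ nPlus ↔ x 1 = 0 ∧ x 2 = 0 ∧ x 4 = 0 ∧ x 5 = 0 := Iff.rfl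

/-- `e` as an element of `𝔫⁺`. -/
noncomputable def eN : nPlus := ⟨e, by simp [e]⟩

/-- `p` as an element of `𝔫⁺`. -/
noncomputable def pN : nPlus := ⟨p, by simp [p]⟩

/-- The Heisenberg subalgebra `𝔥 = span {p, q, z}`. -/
noncomputable def heis : LieSubalgebra ℂ Schrodinger where
  carrier := {x | x 0 = 0 ∧ x 1 = 0 ∧ x 2 = 0}
  add_mem' := by
    rintro x y ⟨h1, h2, h3⟩ ⟨k1, k2, k3⟩
    simp [h1, h2, h3, k1, k2, k3]
  zero_mem' := by simp
  smul_mem' := by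
    rintro t x ⟨h1, h2, h3⟩
    simp [h1, h2, h3]
  lie_mem' := by
    rintro x y ⟨h1, h2, h3⟩ ⟨k1, k2, k3⟩
    simp [h1, h2, h3, k1, k2, k3]

@[simp] theorem mem_heis {x : Schrodinger} : x ∈ heis ↔ x 0 = 0 ∧ x 1 = 0 ∧ x 2 = 0 := Iff.rfl

/-- The subalgebra `sl₂ = span {e, h, f}`. -/
noncomputable def sl2 : LieSubalgebra ℂ Schrodinger where
  carrier := {x | x 3 = 0 ∧ x 4 = 0 ∧ x 5 = 0}
  add_mem' := by
    rintro x y ⟨h1, h2, h3⟩ ⟨k1, k2, k3⟩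
    simp [h1, h2, h3, k1, k2, k3]
  zero_mem' := by simp
  smul_mem' := by
    rintro t x ⟨h1, h2, h3⟩
    simp [h1, h2, h3]
  lie_mem' := by
    rintro x y ⟨h1, h2, h3⟩ ⟨k1, k2, k3⟩
    simp [h1, h2, k1, k2]

@[simp] theorem mem_sl2 {x : Schrodinger} : x ∈ sl2 ↔ x 3 = 0 ∧ x 4 = 0 ∧ x 5 = 0 := Iff.rfl

/-! ## Whittaker modules for `sl₂` -/

/-- `e` as an element of `sl₂`. -/
noncomputable def e2 : sl2 := ⟨e, by simp [e]⟩
/-- `h` as an element of `sl₂`. -/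
noncomputable def h2 : sl2 := ⟨h, by simp [h]⟩
/-- `f` as an element of `sl₂`. -/
noncomputable def f2 : sl2 := ⟨f, by simp [f]⟩

/-- The subalgebra `ℂ e` of `sl₂`. -/
noncomputable def sl2Plus : LieSubalgebra ℂ sl2 where
  carrier := {x | (x : Schrodinger) 1 = 0 ∧ (x : Schrodinger) 2 = 0}
  add_mem' := by
    rintro x y ⟨h1, h2⟩ ⟨k1, k2⟩
    simp [h1, h2, k1, k2]
  zero_mem' := by simp
  smul_mem' := by
    rintro t x ⟨h1, h2⟩
    simp [h1, h2]
  lie_mem' := by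
    rintro x y ⟨h1, h2⟩ ⟨k1, k2⟩
    simp [h1, h2, k1, k2]

/-- The character `e ↦ a` of `ℂ e`. -/
noncomputable def sl2Char (a : ℂ) : LieAlgebra.LieCharacter ℂ sl2Plus where
  toFun x := a * ((x : sl2) : Schrodinger) 0
  map_add' x y := by simp [mul_add]
  map_smul' t x := by simp; ring
  map_lie' := by
    rintro ⟨x, hx1, hx2⟩ ⟨y, hy1, hy2⟩
    simp [LieRing.of_associative_ring_bracket, hx1, hy1, mul_comm]

/-- The Casimir element `Ω = 4fe + 2h + h²` of `U(sl₂)`. -/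
noncomputable def casimir : UniversalEnvelopingAlgebra ℂ sl2 :=
  4 * UniversalEnvelopingAlgebra.ι ℂ f2 * UniversalEnvelopingAlgebra.ι ℂ e2 +
    2 * UniversalEnvelopingAlgebra.ι ℂ h2 + UniversalEnvelopingAlgebra.ι ℂ h2 ^ 2

/-- The universal `sl₂` Whittaker module `W_{sl₂}(a) = U(sl₂) ⊗_{U(ℂe)} ℂ_a`. -/
abbrev sl2Universal (a : ℂ) : Type := InducedModule sl2Plus (sl2Char a)

/-- The submodule `W¹ = U(sl₂)(Ω - c)w` of `W_{sl₂}(a)`. -/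
noncomputable def sl2CasimirSubmodule (a c : ℂ) : LieSubmodule ℂ sl2 (sl2Universal a) :=
  LieSubmodule.lieSpan ℂ sl2
    {(casimir - algebraMap ℂ _ c) • InducedModule.gen sl2Plus (sl2Char a)}

/-- The `sl₂`-module `M_{sl₂}(a, c) = W_{sl₂}(a) / W¹`. -/
abbrev sl2Whittaker (a c : ℂ) : Type := sl2Universal a ⧸ sl2CasimirSubmodule a c

/-- The projection `𝔖 = 𝔥 ⋊ sl₂ → sl₂` with kernel `𝔥`. -/
noncomputable def toSl2 : Schrodinger →ₗ⁅ℂ⁆ sl2 where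
  toFun x := ⟨mk ![x 0, x 1, x 2, 0, 0, 0], by simp⟩
  map_add' x y := by
    apply Subtype.ext; apply ext6 <;> simp
  map_smul' t x := by
    apply Subtype.ext; apply ext6 <;> simp
  map_lie' := by
    intro x y
    apply Subtype.ext; apply ext6 <;> simp

/-- An `sl₂`-module `M` regarded as an `𝔖`-module `M^𝔖` on which `𝔥` acts by zero. -/
def Sl2Inflation (M : Type*) : Type _ := M

namespace Sl2Inflation

variable (M : Type*) [AddCommGroup M] [Module ℂ M] [LieRingModule sl2 M] [LieModule ℂ sl2 M]

instance : AddCommGroup (Sl2Inflation M) := inferInstanceAs (AddCommGroup M)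

instance : Module ℂ (Sl2Inflation M) := inferInstanceAs (Module ℂ M)

noncomputable instance : LieRingModule Schrodinger (Sl2Inflation M) :=
  LieRingModule.compLieHom M toSl2

instance : LieModule ℂ Schrodinger (Sl2Inflation M) :=
  LieModule.compLieHom M toSl2

end Sl2Inflation

/-! ## Whittaker modules for the Heisenberg algebra -/

/-- `p` as an element of `𝔥`. -/
noncomputable def pH : heis := ⟨p, by simp [p]⟩
/-- `q` as an element of `𝔥`. -/
noncomputable def qH : heis := ⟨q, by simp [q]⟩
/-- `z` as an element of `𝔥`. -/
noncomputable def zH : heis := ⟨z, by simp [z]⟩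

/-- The subalgebra `ℂ p ⊕ ℂ z` of `𝔥`. -/
noncomputable def heisPlus : LieSubalgebra ℂ heis where
  carrier := {x | (x : Schrodinger) 4 = 0}
  add_mem' := by
    intro x y hx hy
    simp_all
  zero_mem' := by simp
  smul_mem' := by
    intro t x hx
    simp_all
  lie_mem' := by
    rintro ⟨x, hx0, hx1, hx2⟩ ⟨y, hy0, hy1, hy2⟩ hx hy
    simp_all

/-- The character `p ↦ a`, `z ↦ c` of `ℂ p ⊕ ℂ z`. -/
noncomputable def heisChar (a c : ℂ) : LieAlgebra.LieCharacter ℂ heisPlus where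
  toFun x := a * ((x : heis) : Schrodinger) 3 + c * ((x : heis) : Schrodinger) 5
  map_add' x y := by simp; ring
  map_smul' t x := by simp; ring
  map_lie' := by
    rintro ⟨⟨x, hx0, hx1, hx2⟩, hx⟩ ⟨⟨y, hy0, hy1, hy2⟩, hy⟩
    replace hx : x 4 = 0 := hx
    replace hy : y 4 = 0 := hy
    simp [LieRing.of_associative_ring_bracket, hx, hy, hx0, hx1, hy0, hy1]
    ring

/-- The Whittaker module `M_𝔥(a, c) = U(𝔥) ⊗_{U(ℂp ⊕ ℂz)} ℂ_{a,c}`. -/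
abbrev HeisWhittaker (a c : ℂ) : Type := InducedModule heisPlus (heisChar a c)

/-! ## The localization `U(𝔥)_(z)` and the homomorphism `Φ` -/

/-- The universal enveloping algebra of `𝔥`. -/
abbrev UHeis : Type := UniversalEnvelopingAlgebra ℂ heis

/-- The element `z` of `U(𝔥)`. -/
noncomputable abbrev zU : UHeis := UniversalEnvelopingAlgebra.ι ℂ zH

theorem zU_central (u : UHeis) : zU * u = u * zU := by
  obtain ⟨t, rfl⟩ : ∃ t, UniversalEnvelopingAlgebra.mkAlgHom ℂ heis t = u :=
    RingCon.mk'_surjective _ u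
  induction t using TensorAlgebra.induction with
  | algebraMap r => rw [AlgHom.commutes, Algebra.commutes]
  | ι x =>
    rw [← UniversalEnvelopingAlgebra.ι_apply, ← sub_eq_zero,
      ← LieRing.of_associative_ring_bracket, ← LieHom.map_lie]
    have hx : ⁅zH, x⁆ = 0 := Subtype.ext (relations.2.2.2.2.2.2.2.2.2.2 x)
    rw [hx, map_zero]
  | add a b ha hb => rw [map_add, mul_add, add_mul, ha, hb]
  | mul a b ha hb => rw [map_mul, ← mul_assoc, ha, mul_assoc, hb, mul_assoc]

/-- The multiplicative set `{zⁱ}` in `U(𝔥)`. -/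
noncomputable abbrev zPowers : Submonoid UHeis := Submonoid.powers zU

theorem zPowers_central (s : zPowers) (u : UHeis) : (s : UHeis) * u = u * s := by
  obtain ⟨_, n, rfl⟩ := s
  exact (Commute.pow_left (zU_central u) n)

noncomputable instance : OreLocalization.OreSet zPowers where
  ore_right_cancel r₁ r₂ s hs := ⟨s, by rw [zPowers_central, zPowers_central, hs]⟩
  oreNum r _ := r
  oreDenom _ s := s
  ore_eq r s := zPowers_central s r

/-- The localization `U(𝔥)_(z)` of `U(𝔥)` at the powers of the central element `z`. -/
abbrev UHeisLoc : Type := OreLocalization zPowers UHeis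

/-- The canonical map `U(𝔥) → U(𝔥)_(z)`. -/
noncomputable def toLoc : UHeis →ₐ[ℂ] UHeisLoc where
  __ := (OreLocalization.numeratorRingHom : UHeis →+* UHeisLoc)
  commutes' _ := rfl

/-- The element `z⁻¹` of `U(𝔥)_(z)`. -/
noncomputable def zInv : UHeisLoc :=
  OreLocalization.oreDiv (1 : UHeis) (⟨zU, Submonoid.mem_powers zU⟩ : zPowers)

theorem zInv_mul : zInv * toLoc zU = 1 :=
  (OreLocalization.mul_div_one (p := (1 : UHeis)) (r := zU)
    (s := (⟨zU, Submonoid.mem_powers zU⟩ : zPowers))).trans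
    ((congrArg (fun r : UHeis => OreLocalization.oreDiv r
      (⟨zU, Submonoid.mem_powers zU⟩ : zPowers)) (one_mul zU)).trans
      (OreLocalization.div_eq_one' (Submonoid.mem_powers zU)))

theorem mul_zInv : toLoc zU * zInv = 1 :=
  OreLocalization.mul_inv (R := UHeis) (⟨zU, Submonoid.mem_powers zU⟩ : zPowers) 1

theorem zInv_comm (u : UHeis) : zInv * toLoc u = toLoc u * zInv := by
  calc zInv * toLoc u = zInv * toLoc u * (toLoc zU * zInv) := by rw [mul_zInv, mul_one]
    _ = zInv * (toLoc u * toLoc zU) * zInv := by simp only [mul_assoc]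
    _ = zInv * (toLoc zU * toLoc u) * zInv := by rw [← map_mul, ← map_mul, zU_central]
    _ = toLoc u * zInv := by rw [← mul_assoc, zInv_mul, one_mul]

/-- The Lie algebra homomorphism from `𝔖` to an associative algebra given by six elements that
satisfy the defining relations of `𝔖`. -/
noncomputable def liftRel {A : Type*} [Ring A] [Algebra ℂ A] (E H F P Q Z : A)
    (hHE : ⁅H, E⁆ = (2 : ℂ) • E) (hHF : ⁅H, F⁆ = (-2 : ℂ) • F) (hEF : ⁅E, F⁆ = H)
    (hHP : ⁅H, P⁆ = P) (hHQ : ⁅H, Q⁆ = -Q) (hPQ : ⁅P, Q⁆ = Z)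
    (hEQ : ⁅E, Q⁆ = P) (hPF : ⁅P, F⁆ = -Q) (hFQ : ⁅F, Q⁆ = 0) (hEP : ⁅E, P⁆ = 0)
    (hZE : ⁅Z, E⁆ = 0) (hZH : ⁅Z, H⁆ = 0) (hZF : ⁅Z, F⁆ = 0) (hZP : ⁅Z, P⁆ = 0)
    (hZQ : ⁅Z, Q⁆ = 0) : Schrodinger →ₗ⁅ℂ⁆ A where
  toFun x := x 0 • E + x 1 • H + x 2 • F + x 3 • P + x 4 • Q + x 5 • Z
  map_add' x y := by simp only [add_apply]; module
  map_smul' t x := by simp only [smul_apply, RingHom.id_apply]; module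
  map_lie' := by
    intro x y
    have hEH : ⁅E, H⁆ = -((2 : ℂ) • E) := by rw [← hHE, lie_skew]
    have hFH : ⁅F, H⁆ = -((-2 : ℂ) • F) := by rw [← hHF, lie_skew]
    have hFE : ⁅F, E⁆ = -H := by rw [← hEF, lie_skew]
    have hPH : ⁅P, H⁆ = -P := by rw [← lie_skew, hHP]
    have hQH : ⁅Q, H⁆ = Q := by rw [← lie_skew, hHQ, neg_neg]
    have hQP : ⁅Q, P⁆ = -Z := by rw [← hPQ, lie_skew]
    have hQE : ⁅Q, E⁆ = -P := by rw [← hEQ, lie_skew]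
    have hFP : ⁅F, P⁆ = Q := by rw [← lie_skew, hPF, neg_neg]
    have hQF : ⁅Q, F⁆ = 0 := by rw [← lie_skew, hFQ, neg_zero]
    have hPE : ⁅P, E⁆ = 0 := by rw [← lie_skew, hEP, neg_zero]
    have hEZ : ⁅E, Z⁆ = 0 := by rw [← lie_skew, hZE, neg_zero]
    have hHZ : ⁅H, Z⁆ = 0 := by rw [← lie_skew, hZH, neg_zero]
    have hFZ : ⁅F, Z⁆ = 0 := by rw [← lie_skew, hZF, neg_zero]
    have hPZ : ⁅P, Z⁆ = 0 := by rw [← lie_skew, hZP, neg_zero]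
    have hQZ : ⁅Q, Z⁆ = 0 := by rw [← lie_skew, hZQ, neg_zero]
    simp only [lie_add, add_lie, lie_smul, smul_lie, lie_self, hHE, hHF, hEF, hHP, hHQ, hPQ, hEQ,
      hPF, hFQ, hEP, hZE, hZH, hZF, hZP, hZQ, hEH, hFH, hFE, hPH, hQH, hQP, hQE, hFP, hQF, hPE,
      hEZ, hHZ, hFZ, hPZ, hQZ, lie_apply_zero, lie_apply_one, lie_apply_two, lie_apply_three,
      lie_apply_four, lie_apply_five]
    module

/-- The generators `p`, `q`, `z` in `U(𝔥)_(z)`. -/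
noncomputable abbrev pL : UHeisLoc := toLoc (UniversalEnvelopingAlgebra.ι ℂ pH)
/-- The generators `p`, `q`, `z` in `U(𝔥)_(z)`. -/
noncomputable abbrev qL : UHeisLoc := toLoc (UniversalEnvelopingAlgebra.ι ℂ qH)
/-- The generators `p`, `q`, `z` in `U(𝔥)_(z)`. -/
noncomputable abbrev zL : UHeisLoc := toLoc zU

/-- The image `(1/2) z⁻¹ p²` of `e` under `Φ`. -/
noncomputable def phiE : UHeisLoc := (1 / 2 : ℂ) • (zInv * pL ^ 2)
/-- The image `-z⁻¹ q p - 1/2` of `h` under `Φ`. -/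
noncomputable def phiH : UHeisLoc := -(zInv * (qL * pL)) - (1 / 2 : ℂ) • 1
/-- The image `-(1/2) z⁻¹ q²` of `f` under `Φ`. -/
noncomputable def phiF : UHeisLoc := -((1 / 2 : ℂ) • (zInv * qL ^ 2))

theorem pL_mul_qL : pL * qL = qL * pL + zL := by
  have hpq : ⁅pH, qH⁆ = zH := Subtype.ext relations.2.2.2.2.2.1
  rw [← sub_eq_iff_eq_add', ← map_mul toLoc, ← map_mul toLoc, ← map_sub toLoc,
    ← LieRing.of_associative_ring_bracket, ← LieHom.map_lie, hpq]

theorem phi_relations :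
    ⁅phiH, phiE⁆ = (2 : ℂ) • phiE ∧ ⁅phiH, phiF⁆ = (-2 : ℂ) • phiF ∧ ⁅phiE, phiF⁆ = phiH ∧
    ⁅phiH, pL⁆ = pL ∧ ⁅phiH, qL⁆ = -qL ∧ ⁅pL, qL⁆ = zL ∧
    ⁅phiE, qL⁆ = pL ∧ ⁅pL, phiF⁆ = -qL ∧ ⁅phiF, qL⁆ = 0 ∧ ⁅phiE, pL⁆ = 0 ∧
    ⁅zL, phiE⁆ = 0 ∧ ⁅zL, phiH⁆ = 0 ∧ ⁅zL, phiF⁆ = 0 ∧ ⁅zL, pL⁆ = 0 ∧ ⁅zL, qL⁆ = 0 := by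
  have pq : pL * qL = qL * pL + zL := pL_mul_qL
  have pq' : ∀ a, pL * (qL * a) = qL * (pL * a) + zL * a := fun a => by
    rw [← mul_assoc, pq, add_mul, mul_assoc]
  have pi' : ∀ a, pL * (zInv * a) = zInv * (pL * a) := fun a => by
    rw [← mul_assoc, ← zInv_comm, mul_assoc]
  have qi' : ∀ a, qL * (zInv * a) = zInv * (qL * a) := fun a => by
    rw [← mul_assoc, ← zInv_comm, mul_assoc]
  have pz : pL * zL = zL * pL := by rw [← map_mul toLoc, ← map_mul toLoc, zU_central]
  have qz : qL * zL = zL * qL := by rw [← map_mul toLoc, ← map_mul toLoc, zU_central]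
  have pz' : ∀ a, pL * (zL * a) = zL * (pL * a) := fun a => by
    rw [← mul_assoc, pz, mul_assoc]
  have qz' : ∀ a, qL * (zL * a) = zL * (qL * a) := fun a => by
    rw [← mul_assoc, qz, mul_assoc]
  have iz' : ∀ a, zInv * (zL * a) = a := fun a => by rw [← mul_assoc, zInv_mul, one_mul]
  have zi' : ∀ a, zL * (zInv * a) = a := fun a => by rw [← mul_assoc, mul_zInv, one_mul]
  refine ⟨?_, ?_, ?_, ?_, ?_, ?_, ?_, ?_, ?_, ?_, ?_, ?_, ?_, ?_, ?_⟩ <;>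
  (simp only [phiE, phiH, phiF, LieRing.of_associative_ring_bracket, pow_two, mul_add, mul_sub,
    sub_mul, mul_neg, neg_mul, smul_mul_assoc, mul_smul_comm, mul_assoc, pq, pq', pi', qi', pz, qz,
    pz', qz', zInv_mul, iz', zi', mul_one, one_mul]; try module)

/-- The homomorphism `Φ : U(𝔖) → U(𝔥)_(z)` with
`Φ(e) = (1/2) z⁻¹ p²`, `Φ(f) = -(1/2) z⁻¹ q²`, `Φ(h) = -z⁻¹ q p - 1/2`, and
`Φ(p) = p`, `Φ(q) = q`, `Φ(z) = z`. -/
noncomputable def Phi : UniversalEnvelopingAlgebra ℂ Schrodinger →ₐ[ℂ] UHeisLoc :=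
  have r := phi_relations
  UniversalEnvelopingAlgebra.lift ℂ (liftRel phiE phiH phiF pL qL zL r.1 r.2.1 r.2.2.1
    r.2.2.2.1 r.2.2.2.2.1 r.2.2.2.2.2.1 r.2.2.2.2.2.2.1 r.2.2.2.2.2.2.2.1 r.2.2.2.2.2.2.2.2.1
    r.2.2.2.2.2.2.2.2.2.1 r.2.2.2.2.2.2.2.2.2.2.1 r.2.2.2.2.2.2.2.2.2.2.2.1
    r.2.2.2.2.2.2.2.2.2.2.2.2.1 r.2.2.2.2.2.2.2.2.2.2.2.2.2.1 r.2.2.2.2.2.2.2.2.2.2.2.2.2.2)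

/-! ## The `𝔖`-module `M_𝔥^𝔖(a, c)` -/

/-- `z` acts on `M_𝔥(a, c)` as the scalar `c`. -/
theorem zH_lie (a c : ℂ) (v : HeisWhittaker a c) : ⁅zH, v⁆ = c • v := by
  obtain ⟨u, rfl⟩ := InducedModule.exists_smul_gen _ _ v
  have hz : zH ∈ heisPlus := by change z 4 = 0; simp [z]
  have hc : heisChar a c ⟨zH, hz⟩ = c := by simp [heisChar, zH, z]
  have hg := InducedModule.lie_gen heisPlus (heisChar a c) ⟨zH, hz⟩
  rw [hc, InducedModule.lie_eq_smul] at hg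
  rw [InducedModule.lie_eq_smul, smul_smul, zU_central, mul_smul, hg,
    ← algebraMap_smul UHeis c (InducedModule.gen _ _), ← algebraMap_smul UHeis c (u • _),
    smul_smul, smul_smul, Algebra.commutes]

theorem uAct_zPowers_isUnit {a c : ℂ} (hc : c ≠ 0) (s : zPowers) :
    IsUnit (uAct heis (HeisWhittaker a c) s) := by
  obtain ⟨_, n, rfl⟩ := s
  have hz : uAct heis (HeisWhittaker a c) zU = algebraMap ℂ _ c := by
    ext v
    rw [uAct, UniversalEnvelopingAlgebra.lift_ι_apply]
    exact zH_lie a c v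
  change IsUnit (uAct heis (HeisWhittaker a c) (zU ^ n))
  rw [map_pow, hz]
  exact ((isUnit_iff_ne_zero.2 hc).map (algebraMap ℂ (Module.End ℂ (HeisWhittaker a c)))).pow n

/-- For `c ≠ 0` the action of `U(𝔥)` on `M_𝔥(a, c)` extends to the localization `U(𝔥)_(z)`. -/
noncomputable def locAct (a : ℂ) {c : ℂ} (hc : c ≠ 0) :
    UHeisLoc →ₐ[ℂ] Module.End ℂ (HeisWhittaker a c) where
  __ := OreLocalization.universalHom (uAct heis (HeisWhittaker a c)).toRingHom
    (IsUnit.liftRight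
      (((uAct heis (HeisWhittaker a c)) : UHeis →* Module.End ℂ (HeisWhittaker a c)).comp
        zPowers.subtype) (uAct_zPowers_isUnit hc)) (fun _ => rfl)
  commutes' t := (OreLocalization.universalHom_commutes _ _ _).trans
    ((uAct heis (HeisWhittaker a c)).commutes t)

/-- The `𝔖`-module `M_𝔥^𝔖(a, c)`, `c ≠ 0`: the space `M_𝔥(a, c)`, on which `u ∈ U(𝔖)` acts
as `Φ(u)`. -/
def HeisWhittakerS (a c : ℂ) (_ : c ≠ 0) : Type := HeisWhittaker a c

namespace HeisWhittakerS

variable (a c : ℂ) (hc : c ≠ 0)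

noncomputable instance : AddCommGroup (HeisWhittakerS a c hc) :=
  inferInstanceAs (AddCommGroup (HeisWhittaker a c))

noncomputable instance : Module ℂ (HeisWhittakerS a c hc) :=
  inferInstanceAs (Module ℂ (HeisWhittaker a c))

/-- The representation `x ↦ Φ(x)` of `𝔖` on `M_𝔥(a, c)`. -/
noncomputable def rep : Schrodinger →ₗ⁅ℂ⁆ Module.End ℂ (HeisWhittaker a c) :=
  (((locAct a hc).comp Phi : UniversalEnvelopingAlgebra ℂ Schrodinger →ₐ[ℂ] _) :
    UniversalEnvelopingAlgebra ℂ Schrodinger →ₗ⁅ℂ⁆ _).comp (UniversalEnvelopingAlgebra.ι ℂ)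

noncomputable instance : LieRingModule Schrodinger (HeisWhittakerS a c hc) :=
  LieRingModule.compLieHom (HeisWhittaker a c) (rep a c hc)

instance : LieModule ℂ Schrodinger (HeisWhittakerS a c hc) :=
  LieModule.compLieHom (HeisWhittaker a c) (rep a c hc)

end HeisWhittakerS

end Schrodinger

/-!
Let `c = zDot ≠ 0` and `a = pDot`. The idea is that in level `c` the Heisenberg algebra `𝔥` is the
Weyl algebra, so that an `𝔖`-module is a multiple of `M_𝔥(a, c)`, and `sl₂` acts on the
multiplicity space.

The Heisenberg module `M_𝔥(a, c)` is `ℂ[X]`, with `q` acting as `X` and `p` as `a + c d/dX`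
(`Schrodinger.heisPolyEquiv`). Hence `p - a` is locally nilpotent on it and its kernel is spanned by
the generator. This makes `M_𝔥(a, c)` simple, and more generally shows that every nonzero
submodule of `M_𝔥^𝔖 ⊗ M^𝔖` contains some `gen ⊗ m` with `m ≠ 0`, since `p` acts on the first
factor only. So the submodules of `M_𝔥^𝔖 ⊗ M^𝔖` are controlled by those of `M`, and
`M_𝔥^𝔖 ⊗ M^𝔖` is simple exactly when `M` is (`Schrodinger.isIrreducible_tensor_iff`).

Conversely let `W` be an `𝔖`-module on which `z` acts as `c`. The formulas of `Φ` make sense in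
`End W`, and the differences `x - Φ(x)` form a representation of `𝔖` that vanishes on `𝔥` and
commutes with `𝔥`. So `sl₂` acts through `x - Φ(x)` on the eigenspace `M` of `p` for the eigenvalue
`a`, and `u gen ⊗ m ↦ u m` is a homomorphism of `𝔖`-modules from `M_𝔥^𝔖 ⊗ M^𝔖` to `W`. It is
injective because its kernel contains no `gen ⊗ m` with `m ≠ 0`, and surjective if `W` is generated
by a vector of `M`. This proves that every Whittaker module is such a tensor product, with `M` a
Whittaker module of type `eDot - pDot² / (2 zDot)` (`Schrodinger.exists_equiv_tensor`).

That `Ω` acts by a scalar on a simple `M` is Schur's lemma for modules of countable dimension over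
`ℂ` (`Schrodinger.exists_casimir_eq_smul`). Finally, for `b ≠ 0` a Whittaker `sl₂`-module of type
`e ↦ b` on which `Ω` acts as a given scalar is `ℂ[X]`, with `h` acting as `X` and `e` as
`g(X) ↦ b g(X - 2)`, the action of `f` being forced by `Ω`. This model is simple, because
`g(X) ↦ g(X - 2) - g(X)` lowers degrees. So there is one such module for every value of `Ω`
(`Schrodinger.isIrreducible_sl2Whittaker`, `Schrodinger.nonempty_equiv_sl2Whittaker`).
-/

/-! ### Lie submodules generated by a vector, induced modules -/

section General

variable {L : Type*} [LieRing L]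

/-- Irreducibility is invariant under isomorphism of Lie modules. -/
theorem LieModuleEquiv.isIrreducible_iff {V V' : Type*} [AddCommGroup V] [Module ℂ V]
    [LieRingModule L V] [AddCommGroup V'] [Module ℂ V'] [LieRingModule L V']
    (E : V ≃ₗ⁅ℂ,L⁆ V') : LieModule.IsIrreducible ℂ L V ↔ LieModule.IsIrreducible ℂ L V' :=
  (LieSubmodule.orderIsoMapComap E).isSimpleOrder_iff

/-- A Lie submodule containing a cyclic vector is everything. -/
theorem LieSubmodule.eq_top_of_mem_of_lieSpan_eq_top {V : Type*} [AddCommGroup V] [Module ℂ V]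
    [LieRingModule L V] {v : V} (hv : LieSubmodule.lieSpan ℂ L {v} = ⊤)
    (N : LieSubmodule ℂ L V) (h : v ∈ N) : N = ⊤ :=
  top_le_iff.1 (hv ▸ LieSubmodule.lieSpan_le.2 (Set.singleton_subset_iff.2 h))

/-- Every nonzero vector of an irreducible module is cyclic. -/
theorem LieModule.IsIrreducible.lieSpan_singleton_eq_top {V : Type*} [AddCommGroup V] [Module ℂ V]
    [LieRingModule L V] (hV : LieModule.IsIrreducible ℂ L V) {v : V} (hv : v ≠ 0) :
    LieSubmodule.lieSpan ℂ L {v} = ⊤ :=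
  (hV.eq_bot_or_eq_top _).resolve_left fun h =>
    hv ((LieSubmodule.mem_bot v).1 (h ▸ LieSubmodule.subset_lieSpan (Set.mem_singleton v)))

variable [LieAlgebra ℂ L]

theorem uAct_ι {V : Type*} [AddCommGroup V] [Module ℂ V] [LieRingModule L V] [LieModule ℂ L V]
    (x : L) (v : V) : uAct L V (UniversalEnvelopingAlgebra.ι ℂ x) v = ⁅x, v⁆ := by
  rw [uAct, UniversalEnvelopingAlgebra.lift_ι_apply, LieModule.toEnd_apply_apply]

/-- Induction for elements of the universal enveloping algebra. -/
theorem UniversalEnvelopingAlgebra.induction_on {motive : UniversalEnvelopingAlgebra ℂ L → Prop}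
    (u : UniversalEnvelopingAlgebra ℂ L) (algebraMap : ∀ r, motive (algebraMap ℂ _ r))
    (ι : ∀ x, motive (UniversalEnvelopingAlgebra.ι ℂ x))
    (add : ∀ a b, motive a → motive b → motive (a + b))
    (mul : ∀ a b, motive a → motive b → motive (a * b)) : motive u := by
  obtain ⟨t, rfl⟩ : ∃ t, UniversalEnvelopingAlgebra.mkAlgHom ℂ L t = u :=
    RingCon.mk'_surjective _ u
  induction t using TensorAlgebra.induction with
  | algebraMap r => rw [AlgHom.commutes]; exact algebraMap r
  | ι x => rw [← UniversalEnvelopingAlgebra.ι_apply]; exact ι x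
  | add a b ha hb => rw [map_add]; exact add _ _ ha hb
  | mul a b ha hb => rw [map_mul]; exact mul _ _ ha hb

/-- A Lie submodule is stable under the universal enveloping algebra. -/
theorem LieSubmodule.uAct_mem {V : Type*} [AddCommGroup V] [Module ℂ V] [LieRingModule L V]
    [LieModule ℂ L V] (N : LieSubmodule ℂ L V) (u : UniversalEnvelopingAlgebra ℂ L) {v : V}
    (hv : v ∈ N) : uAct L V u v ∈ N := by
  induction u using UniversalEnvelopingAlgebra.induction_on generalizing v with
  | algebraMap r => rw [AlgHom.commutes]; exact N.smul_mem r hv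
  | ι x => rw [uAct_ι]; exact N.lie_mem hv
  | add a b ha hb => rw [map_add]; exact N.add_mem (ha hv) (hb hv)
  | mul a b ha hb => rw [map_mul]; exact ha (hb hv)

/-- Homomorphisms of Lie modules commute with the universal enveloping algebra. -/
theorem LieModuleHom.map_uAct {V V' : Type*} [AddCommGroup V] [Module ℂ V] [LieRingModule L V]
    [LieModule ℂ L V] [AddCommGroup V'] [Module ℂ V'] [LieRingModule L V'] [LieModule ℂ L V']
    (T : V →ₗ⁅ℂ,L⁆ V') (u : UniversalEnvelopingAlgebra ℂ L) (v : V) :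
    T (uAct L V u v) = uAct L V' u (T v) := by
  induction u using UniversalEnvelopingAlgebra.induction_on generalizing v with
  | algebraMap r => rw [AlgHom.commutes, AlgHom.commutes]; exact T.map_smul r v
  | ι x => rw [uAct_ι, uAct_ι, LieModuleHom.map_lie]
  | add a b ha hb =>
    rw [map_add, map_add, LinearMap.add_apply, LinearMap.add_apply, map_add, ha, hb]
  | mul a b ha hb => rw [map_mul, map_mul, Module.End.mul_apply, Module.End.mul_apply, ha, hb]

namespace InducedModule

variable (n : LieSubalgebra ℂ L) (φ : LieAlgebra.LieCharacter ℂ n)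

theorem uAct_eq_smul (u : UniversalEnvelopingAlgebra ℂ L) (w : InducedModule n φ) :
    uAct L (InducedModule n φ) u w = u • w := by
  induction u using UniversalEnvelopingAlgebra.induction_on generalizing w with
  | algebraMap r => rw [AlgHom.commutes, algebraMap_smul]; rfl
  | ι x => rw [uAct_ι, lie_eq_smul]
  | add a b ha hb => rw [map_add, LinearMap.add_apply, add_smul, ha, hb]
  | mul a b ha hb => rw [map_mul, Module.End.mul_apply, mul_smul, ha, hb]

theorem lieSpan_gen : LieSubmodule.lieSpan ℂ L {gen n φ} = ⊤ := by
  rw [eq_top_iff]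
  intro w _
  obtain ⟨u, rfl⟩ := exists_smul_gen n φ w
  rw [← uAct_eq_smul]
  exact LieSubmodule.uAct_mem _ u (LieSubmodule.subset_lieSpan (Set.mem_singleton _))

variable {n φ} {V : Type*} [AddCommGroup V] [Module ℂ V]

/-- The linear map from the induced module to a representation space `V` of `L` that sends the
generator to a given vector `v` on which `n` acts through `φ`. The representation is given as a
homomorphism into `End V`, so that different representations on one space can be used. -/
noncomputable def lift (ρ : L →ₗ⁅ℂ⁆ Module.End ℂ V) (v : V)
    (hv : ∀ x : n, ρ (x : L) v = φ x • v) : InducedModule n φ →ₗ[ℂ] V :=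
  Submodule.liftQ ((whittakerIdeal n φ).restrictScalars ℂ)
    ((LinearMap.applyₗ v).comp (UniversalEnvelopingAlgebra.lift ℂ ρ).toLinearMap) (by
      intro u hu
      rw [Submodule.restrictScalars_mem] at hu
      rw [LinearMap.mem_ker, LinearMap.comp_apply, AlgHom.toLinearMap_apply,
        LinearMap.applyₗ_apply_apply]
      induction hu using Submodule.span_induction with
      | mem u hu =>
        obtain ⟨x, rfl⟩ := hu
        rw [map_sub, UniversalEnvelopingAlgebra.lift_ι_apply, AlgHom.commutes,
          LinearMap.sub_apply, hv, Module.algebraMap_end_apply, sub_self]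
      | zero => rw [map_zero, LinearMap.zero_apply]
      | add a b _ _ ha hb => rw [map_add, LinearMap.add_apply, ha, hb, add_zero]
      | smul a b _ hb => rw [smul_eq_mul, map_mul, Module.End.mul_apply, hb, map_zero])

variable {ρ : L →ₗ⁅ℂ⁆ Module.End ℂ V} {v : V} {hv : ∀ x : n, ρ (x : L) v = φ x • v}

theorem lift_smul_gen (u : UniversalEnvelopingAlgebra ℂ L) :
    lift ρ v hv (u • gen n φ) = UniversalEnvelopingAlgebra.lift ℂ ρ u v := by
  rw [smul_gen_eq_mk]; rfl

@[simp] theorem lift_gen : lift ρ v hv (gen n φ) = v := by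
  simpa using lift_smul_gen (hv := hv) 1

theorem lift_lie (x : L) (w : InducedModule n φ) : lift ρ v hv ⁅x, w⁆ = ρ x (lift ρ v hv w) := by
  obtain ⟨u, rfl⟩ := exists_smul_gen n φ w
  rw [lie_eq_smul, smul_smul, lift_smul_gen, lift_smul_gen, map_mul, Module.End.mul_apply,
    UniversalEnvelopingAlgebra.lift_ι_apply]

/-- Two intertwiners on an induced module agree when they agree on the generator. -/
theorem linearMap_ext (ρ : L →ₗ⁅ℂ⁆ Module.End ℂ V) {S T : InducedModule n φ →ₗ[ℂ] V}
    (hS : ∀ x w, S ⁅x, w⁆ = ρ x (S w)) (hT : ∀ x w, T ⁅x, w⁆ = ρ x (T w))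
    (h : S (gen n φ) = T (gen n φ)) : S = T := by
  let N : LieSubmodule ℂ L (InducedModule n φ) :=
    { LinearMap.eqLocus S T with
      lie_mem := fun {x w} hw => by
        change S ⁅x, w⁆ = T ⁅x, w⁆
        rw [hS, hT, show S w = T w from hw] }
  have hN : N = ⊤ := LieSubmodule.eq_top_of_mem_of_lieSpan_eq_top (lieSpan_gen n φ) N h
  ext w
  exact (hN ▸ LieSubmodule.mem_top w : w ∈ N)

end InducedModule

end General

/-! ### Locally nilpotent operators -/

section LocallyNilpotent

variable {V : Type*} [AddCommGroup V] [Module ℂ V]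

/-- Applying a locally nilpotent operator to a nonzero vector often enough, but not too often,
gives a nonzero vector of the kernel. -/
theorem Module.End.exists_pow_ne_zero_of_locallyNilpotent (D : Module.End ℂ V)
    (hD : ∀ v, ∃ k, (D ^ k) v = 0) {v : V} (hv : v ≠ 0) :
    ∃ k, (D ^ k) v ≠ 0 ∧ D ((D ^ k) v) = 0 := by
  classical
  rcases hk : Nat.find (hD v) with _ | k
  · exact absurd (by simpa [hk] using Nat.find_spec (hD v)) hv
  · refine ⟨k, Nat.find_min (hD v) (by omega), ?_⟩
    rw [← Module.End.mul_apply, ← pow_succ', ← hk]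
    exact Nat.find_spec (hD v)

/-- If `D` is locally nilpotent on `V` with kernel spanned by `g`, then on `V ⊗ M` every nonzero
vector is carried by some power of `D ⊗ 1` to a nonzero vector `g ⊗ m`. -/
theorem TensorProduct.exists_rTensor_pow_eq_tmul {M : Type*} [AddCommGroup M] [Module ℂ M]
    (D : Module.End ℂ V) (hD : ∀ v, ∃ k, (D ^ k) v = 0) (g : V)
    (hker : ∀ v, D v = 0 → ∃ t : ℂ, v = t • g) {w : V ⊗[ℂ] M} (hw : w ≠ 0) :
    ∃ k, ∃ m : M, m ≠ 0 ∧ ((D.rTensor M) ^ k) w = g ⊗ₜ m := by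
  have hpow : ∀ k, (D.rTensor M : Module.End ℂ (V ⊗[ℂ] M)) ^ k = (D ^ k).rTensor M := fun k =>
    LinearMap.rTensor_pow D k
  have hnil : ∀ w : V ⊗[ℂ] M, ∃ k, ((D.rTensor M : Module.End ℂ (V ⊗[ℂ] M)) ^ k) w = 0 := by
    intro w
    induction w with
    | zero => exact ⟨0, map_zero _⟩
    | tmul v m =>
      obtain ⟨k, hk⟩ := hD v
      exact ⟨k, by rw [hpow, LinearMap.rTensor_tmul, hk, TensorProduct.zero_tmul]⟩
    | add w₁ w₂ h₁ h₂ =>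
      obtain ⟨k₁, h₁⟩ := h₁
      obtain ⟨k₂, h₂⟩ := h₂
      refine ⟨k₁ + k₂, ?_⟩
      rw [map_add, pow_add, Module.End.mul_apply, Module.End.mul_apply, h₂, map_zero, add_zero,
        ← Module.End.mul_apply, ← pow_add, add_comm k₁, pow_add, Module.End.mul_apply, h₁, map_zero]
  obtain ⟨k, hk0, hk1⟩ := Module.End.exists_pow_ne_zero_of_locallyNilpotent _ hnil hw
  -- Flatness: the kernel of `D ⊗ 1` is the image of `ker D ⊗ M`.
  have hex := Module.Flat.rTensor_exact M (LinearMap.exact_subtype_ker_map D)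
  obtain ⟨y, hy⟩ := (hex _).1 hk1
  have hrange : ∀ y : (LinearMap.ker D) ⊗[ℂ] M, ∃ m : M,
      (LinearMap.ker D).subtype.rTensor M y = g ⊗ₜ m := by
    intro y
    induction y with
    | zero => exact ⟨0, by simp⟩
    | tmul v m =>
      obtain ⟨t, ht⟩ := hker v v.2
      exact ⟨t • m, by rw [LinearMap.rTensor_tmul, Submodule.subtype_apply, ht,
        TensorProduct.smul_tmul]⟩
    | add y₁ y₂ h₁ h₂ =>
      obtain ⟨m₁, h₁⟩ := h₁
      obtain ⟨m₂, h₂⟩ := h₂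
      exact ⟨m₁ + m₂, by rw [map_add, h₁, h₂, TensorProduct.tmul_add]⟩
  obtain ⟨m, hm⟩ := hrange y
  refine ⟨k, m, ?_, hy.symm.trans hm⟩
  rintro rfl
  exact hk0 (by rw [← hy, hm, TensorProduct.tmul_zero])

/-- Over a field, `g ⊗ m ≠ 0` as soon as `g ≠ 0` and `m ≠ 0`. -/
theorem TensorProduct.eq_zero_of_tmul_eq_zero {M : Type*} [AddCommGroup M] [Module ℂ M]
    {g : V} (hg : g ≠ 0) {m : M} (h : g ⊗ₜ[ℂ] m = 0) : m = 0 := by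
  obtain ⟨ℓ, hℓ⟩ : ∃ ℓ : Module.Dual ℂ V, ℓ g ≠ 0 := by
    by_contra! hall
    exact hg ((Module.forall_dual_apply_eq_zero_iff ℂ g).1 hall)
  have := congrArg (TensorProduct.lid ℂ M ∘ ℓ.rTensor M) h
  simpa [hℓ] using this

end LocallyNilpotent

/-! ### Schur's lemma in countable dimension -/

section Schur

open Polynomial

variable {V : Type*} [AddCommGroup V] [Module ℂ V]

/-- An operator `T` such that all `T - c` are injective has all nonzero polynomials in `T`
injective, as these split into linear factors. -/
theorem Polynomial.aeval_injective_of_forall_sub_injective (T : Module.End ℂ V)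
    (hT : ∀ c : ℂ, Function.Injective (T - algebraMap ℂ (Module.End ℂ V) c)) {P : ℂ[X]} (hP : P ≠ 0) :
    Function.Injective (aeval T P) := by
  have hprod : ∀ m : Multiset ℂ,
      Function.Injective (aeval T (m.map fun c => X - C c).prod) := by
    intro m
    induction m using Multiset.induction with
    | empty =>
      rw [Multiset.map_zero, Multiset.prod_zero, map_one]
      exact Function.injective_id
    | cons c m ih =>
      rw [Multiset.map_cons, Multiset.prod_cons, map_mul, map_sub, aeval_X, aeval_C]
      exact (hT c).comp ih
  rw [(IsAlgClosed.splits P).eq_prod_roots, map_mul, aeval_C]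
  exact (smul_right_injective V (leadingCoeff_ne_zero.2 hP)).comp (hprod P.roots)

/-- On a nonzero complex vector space of countable dimension, some `T - c` is not bijective:
otherwise the vectors `(T - c)⁻¹ w`, with `c` running through the uncountable field `ℂ`, would be
linearly independent. -/
theorem Module.End.exists_not_bijective_sub (T : Module.End ℂ V) {S : Set V} (hS : S.Countable)
    (hspan : Submodule.span ℂ S = ⊤) [Nontrivial V] :
    ∃ c : ℂ, ¬ Function.Bijective (T - algebraMap ℂ (Module.End ℂ V) c) := by
  by_contra! hT
  obtain ⟨w, hw⟩ := exists_ne (0 : V)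
  choose y hy using fun c => (hT c).2 w
  have hli : LinearIndependent ℂ y := by
    classical
    rw [linearIndependent_iff']
    intro s g hg c hc
    let R : ℂ[X] := ∑ d ∈ s, C (g d) * ∏ b ∈ s.erase d, (X - C b)
    have hR : aeval T R w = 0 := by
      have h := congrArg (aeval T (∏ b ∈ s, (X - C b))) hg
      rw [map_zero, map_sum] at h
      rw [map_sum, LinearMap.sum_apply, ← h]
      refine Finset.sum_congr rfl fun d hd => ?_
      rw [← Finset.prod_erase_mul _ _ hd, map_mul, map_mul, map_smul, Module.End.mul_apply,
        map_sub, aeval_X, aeval_C, aeval_C, Module.End.mul_apply _ (T - _), hy]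
      rfl
    have hR0 : R = 0 := by
      by_contra hne
      exact hw (Polynomial.aeval_injective_of_forall_sub_injective T (fun c => (hT c).1) hne
        (hR.trans (map_zero _).symm))
    have h := congrArg (eval c) hR0
    simp only [R, eval_finsetSum, eval_mul, eval_C, eval_prod, eval_sub, eval_X, eval_zero] at h
    rw [Finset.sum_eq_single_of_mem c hc] at h
    · refine (mul_eq_zero.1 h).resolve_right (Finset.prod_ne_zero_iff.2 fun b hb => ?_)
      exact sub_ne_zero.2 (Finset.ne_of_mem_erase hb).symm
    · intro d _ hdc
      rw [Finset.prod_eq_zero (Finset.mem_erase.2 ⟨hdc.symm, hc⟩) (sub_self c), mul_zero]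
  have h1 := hli.cardinal_lift_le_rank
  have h2 : Module.rank ℂ V ≤ Cardinal.aleph0 := by
    rw [← rank_top, ← hspan]
    exact (rank_span_le S).trans (Cardinal.le_aleph0_iff_set_countable.2 hS)
  have h3 := h1.trans (Cardinal.lift_le.2 h2)
  rw [Cardinal.mk_complex, Cardinal.lift_continuum, Cardinal.lift_aleph0] at h3
  exact absurd h3 (not_le.2 Cardinal.aleph0_lt_continuum)

end Schur

/-! ### Extending representations of the Heisenberg algebra to the Schrödinger algebra -/

namespace Schrodinger

section Oscillator

variable {A : Type*} [Ring A] [Algebra ℂ A]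

theorem heis_eq (x : heis) :
    x = (x : Schrodinger) 3 • pH + (x : Schrodinger) 4 • qH + (x : Schrodinger) 5 • zH := by
  obtain ⟨x, h0, h1, h2⟩ := x
  apply Subtype.ext
  apply ext6 <;> simp [pH, qH, zH, p, q, z, h0, h1, h2]

/-- The value of a homomorphism on `𝔥` that maps `z` to a scalar. -/
theorem heis_map_eq (ρ : heis →ₗ⁅ℂ⁆ A) {c : ℂ} (hρ : ρ zH = c • 1) (x : heis) :
    ρ x = (x : Schrodinger) 3 • ρ pH + (x : Schrodinger) 4 • ρ qH +
      (x : Schrodinger) 5 • c • (1 : A) := by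
  conv_lhs => rw [heis_eq x]
  rw [map_add, map_add, map_smul, map_smul, map_smul, hρ]

theorem heis_map_pH_mul_qH (ρ : heis →ₗ⁅ℂ⁆ A) {c : ℂ} (hρ : ρ zH = c • 1) :
    ρ pH * ρ qH = ρ qH * ρ pH + c • 1 := by
  have hpq : ⁅pH, qH⁆ = zH := Subtype.ext relations.2.2.2.2.2.1
  rw [← hρ, ← hpq, LieHom.map_lie, LieRing.of_associative_ring_bracket, add_sub_cancel]

theorem oscillator_relations {P Q : A} {c : ℂ} (hc : c ≠ 0) (h : P * Q = Q * P + c • 1) :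
    let E : A := (1 / 2 : ℂ) • c⁻¹ • P ^ 2
    let H : A := -(c⁻¹ • (Q * P)) - (1 / 2 : ℂ) • 1
    let F : A := -((1 / 2 : ℂ) • c⁻¹ • Q ^ 2)
    ⁅H, E⁆ = (2 : ℂ) • E ∧ ⁅H, F⁆ = (-2 : ℂ) • F ∧ ⁅E, F⁆ = H ∧
    ⁅H, P⁆ = P ∧ ⁅H, Q⁆ = -Q ∧ ⁅P, Q⁆ = c • 1 ∧
    ⁅E, Q⁆ = P ∧ ⁅P, F⁆ = -Q ∧ ⁅F, Q⁆ = 0 ∧ ⁅E, P⁆ = 0 := by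
  have h' : ∀ a, P * (Q * a) = Q * (P * a) + c • a := fun a => by
    rw [← mul_assoc, h, add_mul, mul_assoc, smul_one_mul]
  intro E H F
  refine ⟨?_, ?_, ?_, ?_, ?_, ?_, ?_, ?_, ?_, ?_⟩ <;>
  (simp only [E, H, F, LieRing.of_associative_ring_bracket, pow_two, mul_add, mul_sub,
    sub_mul, mul_neg, neg_mul, smul_mul_assoc, mul_smul_comm, mul_assoc, h, h', mul_one, one_mul,
    smul_add, smul_smul]
   match_scalars <;> field_simp <;> ring)

/-- A homomorphism `ρ` from the Heisenberg algebra to an associative algebra with `ρ(z) = c ≠ 0`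
extends to the Schrödinger algebra by the formulas of `Φ`: `e ↦ p² / (2c)`, `h ↦ -qp / c - 1/2`,
`f ↦ -q² / (2c)`. -/
noncomputable def oscillator (ρ : heis →ₗ⁅ℂ⁆ A) {c : ℂ} (hc : c ≠ 0) (hρ : ρ zH = c • 1) :
    Schrodinger →ₗ⁅ℂ⁆ A :=
  have r := oscillator_relations hc (heis_map_pH_mul_qH ρ hρ)
  have hz : ∀ y : A, ⁅c • (1 : A), y⁆ = 0 := fun y => by
    rw [LieRing.of_associative_ring_bracket, smul_one_mul, mul_smul_one, sub_self]
  liftRel ((1 / 2 : ℂ) • c⁻¹ • ρ pH ^ 2) (-(c⁻¹ • (ρ qH * ρ pH)) - (1 / 2 : ℂ) • 1)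
    (-((1 / 2 : ℂ) • c⁻¹ • ρ qH ^ 2)) (ρ pH) (ρ qH) (c • 1) r.1 r.2.1 r.2.2.1
    r.2.2.2.1 r.2.2.2.2.1 r.2.2.2.2.2.1 r.2.2.2.2.2.2.1 r.2.2.2.2.2.2.2.1 r.2.2.2.2.2.2.2.2.1
    r.2.2.2.2.2.2.2.2.2
    (hz _) (hz _) (hz _) (hz _) (hz _)

theorem oscillator_apply (ρ : heis →ₗ⁅ℂ⁆ A) {c : ℂ} (hc : c ≠ 0) (hρ : ρ zH = c • 1)
    (x : Schrodinger) :
    oscillator ρ hc hρ x = x 0 • ((1 / 2 : ℂ) • c⁻¹ • ρ pH ^ 2) +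
      x 1 • (-(c⁻¹ • (ρ qH * ρ pH)) - (1 / 2 : ℂ) • 1) +
      x 2 • (-((1 / 2 : ℂ) • c⁻¹ • ρ qH ^ 2)) + x 3 • ρ pH + x 4 • ρ qH + x 5 • c • (1 : A) := rfl

theorem oscillator_heis (ρ : heis →ₗ⁅ℂ⁆ A) {c : ℂ} (hc : c ≠ 0) (hρ : ρ zH = c • 1) (x : heis) :
    oscillator ρ hc hρ x = ρ x := by
  rw [oscillator_apply, heis_map_eq ρ hρ x, x.2.1, x.2.2.1, x.2.2.2]
  simp only [zero_smul, zero_add]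

theorem commute_oscillator (ρ : heis →ₗ⁅ℂ⁆ A) {c : ℂ} (hc : c ≠ 0) (hρ : ρ zH = c • 1) {y : A}
    (hy : ∀ x, Commute y (ρ x)) (x : Schrodinger) : Commute y (oscillator ρ hc hρ x) := by
  have hp := hy pH
  have hq := hy qH
  have h1 := Commute.one_right y
  rw [oscillator_apply]
  exact ((((((((hp.pow_right 2).smul_right _).smul_right _).smul_right _).add_right
    (((((hq.mul_right hp).smul_right _).neg_right).sub_right (h1.smul_right _)).smul_right
    _)).add_right ((((hq.pow_right 2).smul_right _).smul_right _).neg_right.smul_right _)).add_right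
    (hp.smul_right _)).add_right (hq.smul_right _)).add_right ((h1.smul_right _).smul_right _)

/-- Intertwiners for `𝔥` are intertwiners for the extended representations of `𝔖`. -/
theorem oscillator_intertwine {V V' : Type*} [AddCommGroup V] [Module ℂ V] [AddCommGroup V']
    [Module ℂ V'] (ρ : heis →ₗ⁅ℂ⁆ Module.End ℂ V) (ρ' : heis →ₗ⁅ℂ⁆ Module.End ℂ V') {c : ℂ}
    (hc : c ≠ 0) (hρ : ρ zH = c • 1) (hρ' : ρ' zH = c • 1) (T : V →ₗ[ℂ] V')
    (hT : ∀ x v, T (ρ x v) = ρ' x (T v)) (x : Schrodinger) (v : V) :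
    T (oscillator ρ hc hρ x v) = oscillator ρ' hc hρ' x (T v) := by
  simp only [oscillator_apply, LinearMap.add_apply, LinearMap.sub_apply, LinearMap.neg_apply,
    LinearMap.smul_apply, pow_two, Module.End.mul_apply, Module.End.one_apply, map_add, map_sub,
    map_neg, map_smul, hT]

end Oscillator

/-! ### The polynomial model of the Heisenberg Whittaker module -/

section HeisModel

open Polynomial

variable (a c : ℂ)

/-- The representation of `𝔥` on `ℂ[X]` in which `p` acts as `a + c d/dX`, `q` as multiplication
by `X` and `z` as `c`. -/
noncomputable def heisPolyRep : heis →ₗ⁅ℂ⁆ Module.End ℂ ℂ[X] where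
  toFun x := (x : Schrodinger) 3 • (a • 1 + c • derivative) +
    (x : Schrodinger) 4 • LinearMap.mulLeft ℂ X + (x : Schrodinger) 5 • c • 1
  map_add' x y := by
    rw [show ((x + y : heis) : Schrodinger) = x + y from rfl]
    simp only [add_apply]
    module
  map_smul' t x := by
    rw [show ((t • x : heis) : Schrodinger) = t • (x : Schrodinger) from rfl]
    simp only [smul_apply, RingHom.id_apply]
    module
  map_lie' := by
    rintro ⟨x, hx0, hx1, hx2⟩ ⟨y, hy0, hy1, hy2⟩
    refine LinearMap.ext fun g => ?_
    simp only [LieSubalgebra.coe_bracket, lie_apply_three,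
      lie_apply_four, lie_apply_five, hx0, hx1, hx2, hy0, hy1, hy2,
      LieRing.of_associative_ring_bracket, LinearMap.sub_apply,
      Module.End.mul_apply, LinearMap.add_apply, LinearMap.smul_apply, Module.End.one_apply,
      LinearMap.mulLeft_apply, one_mul, derivative_mul, derivative_X, mul_add,
      mul_smul_comm]
    module

variable {a c}

theorem heisPolyRep_apply (x : heis) (g : ℂ[X]) :
    heisPolyRep a c x g = (x : Schrodinger) 3 • (a • g + c • derivative g) +
      (x : Schrodinger) 4 • (X * g) + (x : Schrodinger) 5 • c • g := rfl

theorem heisPolyRep_one (x : heisPlus) :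
    heisPolyRep a c (x : heis) 1 = heisChar a c x • (1 : ℂ[X]) := by
  have h4 : ((x : heis) : Schrodinger) 4 = 0 := x.2
  have hx : heisChar a c x = a * ((x : heis) : Schrodinger) 3 + c * ((x : heis) : Schrodinger) 5 :=
    rfl
  rw [heisPolyRep_apply, h4, hx, derivative_one]
  module

theorem toEnd_zH : LieModule.toEnd ℂ heis (HeisWhittaker a c) zH = c • 1 :=
  LinearMap.ext fun v => zH_lie a c v

theorem pH_lie_gen :
    ⁅pH, InducedModule.gen heisPlus (heisChar a c)⁆ = a • InducedModule.gen _ (heisChar a c) := by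
  have hp : pH ∈ heisPlus := by change p 4 = 0; simp [p]
  have h := InducedModule.lie_gen heisPlus (heisChar a c) ⟨pH, hp⟩
  have hc : heisChar a c ⟨pH, hp⟩ = a := by simp [heisChar, pH, p]
  rwa [hc] at h

/-- The map `ℂ[X] → M_𝔥(a, c)`, `g ↦ g(q) w`. -/
noncomputable def heisPolyMap (a c : ℂ) : ℂ[X] →ₗ[ℂ] HeisWhittaker a c :=
  (LinearMap.applyₗ (InducedModule.gen heisPlus (heisChar a c))).comp
    (aeval (LieModule.toEnd ℂ heis (HeisWhittaker a c) qH)).toLinearMap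

theorem heisPolyMap_one : heisPolyMap a c 1 = InducedModule.gen _ _ := by
  change aeval (LieModule.toEnd ℂ heis (HeisWhittaker a c) qH) (1 : ℂ[X]) _ = _
  rw [map_one]; rfl

theorem heisPolyMap_X_mul (g : ℂ[X]) : heisPolyMap a c (X * g) = ⁅qH, heisPolyMap a c g⁆ := by
  change aeval (LieModule.toEnd ℂ heis (HeisWhittaker a c) qH) (X * g) _ = _
  rw [map_mul, aeval_X]; rfl

theorem pH_lie_heisPolyMap (g : ℂ[X]) :
    ⁅pH, heisPolyMap a c g⁆ = heisPolyMap a c (a • g + c • derivative g) := by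
  induction g using Polynomial.induction_on with
  | C t =>
    rw [derivative_C, smul_zero, add_zero, C_eq_algebraMap, Algebra.algebraMap_eq_smul_one,
      map_smul, map_smul, map_smul, lie_smul, heisPolyMap_one, pH_lie_gen, smul_comm]
  | add g₁ g₂ h₁ h₂ => rw [map_add, lie_add, h₁, h₂, ← map_add, map_add derivative]; congr 1; module
  | monomial n t ih =>
    have hpq : ⁅pH, qH⁆ = zH := Subtype.ext relations.2.2.2.2.2.1
    rw [show C t * X ^ (n + 1) = X * (C t * X ^ n) by ring, heisPolyMap_X_mul, leibniz_lie, hpq,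
      zH_lie, ih, ← heisPolyMap_X_mul, ← map_smul, ← map_add, derivative_mul (f := X),
      derivative_X, one_mul, mul_add, mul_smul_comm, mul_smul_comm]
    congr 1
    module

theorem heisPolyMap_intertwine (x : heis) (g : ℂ[X]) :
    heisPolyMap a c (heisPolyRep a c x g) = ⁅x, heisPolyMap a c g⁆ := by
  conv_rhs => rw [heis_eq x]
  rw [add_lie, add_lie, smul_lie, smul_lie, smul_lie, pH_lie_heisPolyMap, ← heisPolyMap_X_mul,
    zH_lie, heisPolyRep_apply]
  simp only [map_add, map_smul]

/-- The Whittaker module `M_𝔥(a, c)` is `ℂ[X]`, through `g ↦ g(q) w`. -/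
noncomputable def heisPolyEquiv (a c : ℂ) : ℂ[X] ≃ₗ[ℂ] HeisWhittaker a c :=
  LinearEquiv.ofLinearMap (heisPolyMap a c)
    (InducedModule.lift (heisPolyRep a c) 1 heisPolyRep_one)
    (InducedModule.linearMap_ext (LieModule.toEnd ℂ heis (HeisWhittaker a c))
      (fun x w => by
        rw [LinearMap.comp_apply, InducedModule.lift_lie, heisPolyMap_intertwine]; rfl)
      (fun _ _ => rfl)
      (by rw [LinearMap.comp_apply, InducedModule.lift_gen, heisPolyMap_one]; rfl))
    (by
      ext1 n
      induction n with
      | zero =>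
        ext1
        simp only [LinearMap.comp_apply, monomial_zero_one, heisPolyMap_one,
          InducedModule.lift_gen, LinearMap.id_apply]
      | succ n ih =>
        have hq : ∀ g : ℂ[X], heisPolyRep a c qH g = X * g := fun g => by
          rw [heisPolyRep_apply]; simp [qH, q]
        have h := LinearMap.congr_fun ih 1
        ext1
        simp only [LinearMap.comp_apply, LinearMap.id_apply] at h ⊢
        rw [← X_mul_monomial, heisPolyMap_X_mul, InducedModule.lift_lie, h, hq])

theorem heisPolyEquiv_apply (g : ℂ[X]) : heisPolyEquiv a c g = heisPolyMap a c g := rfl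

theorem heisWhittaker_gen_ne_zero : InducedModule.gen heisPlus (heisChar a c) ≠ 0 := by
  rw [← heisPolyMap_one, ← heisPolyEquiv_apply]
  exact (heisPolyEquiv a c).map_ne_zero_iff.2 one_ne_zero

/-- The operator `p - a` on `M_𝔥(a, c)`. -/
noncomputable def heisLowering (a c : ℂ) : Module.End ℂ (HeisWhittaker a c) :=
  LieModule.toEnd ℂ heis (HeisWhittaker a c) pH - a • 1

theorem heisLowering_apply (w : HeisWhittaker a c) : heisLowering a c w = ⁅pH, w⁆ - a • w := rfl

theorem heisLowering_heisPolyMap (g : ℂ[X]) :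
    heisLowering a c (heisPolyMap a c g) = c • heisPolyMap a c (derivative g) := by
  rw [heisLowering_apply, pH_lie_heisPolyMap, map_add, map_smul, map_smul, add_sub_cancel_left]

theorem heisLowering_locallyNilpotent (w : HeisWhittaker a c) :
    ∃ k, (heisLowering a c ^ k) w = 0 := by
  obtain ⟨g, rfl⟩ := (heisPolyEquiv a c).surjective w
  have h : ∀ k, (heisLowering a c ^ k) (heisPolyMap a c g) =
      c ^ k • heisPolyMap a c (derivative^[k] g) := by
    intro k
    induction k with
    | zero => simp
    | succ k ih =>
      rw [pow_succ', Module.End.mul_apply, ih, map_smul, heisLowering_heisPolyMap,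
        Function.iterate_succ_apply', smul_smul, pow_succ]
  refine ⟨g.natDegree + 1, ?_⟩
  rw [heisPolyEquiv_apply, h, iterate_derivative_eq_zero (Nat.lt_succ_self _), map_zero, smul_zero]

theorem heisLowering_ker (hc : c ≠ 0) (w : HeisWhittaker a c) (hw : heisLowering a c w = 0) :
    ∃ t : ℂ, w = t • InducedModule.gen heisPlus (heisChar a c) := by
  obtain ⟨g, rfl⟩ := (heisPolyEquiv a c).surjective w
  rw [heisPolyEquiv_apply, heisLowering_heisPolyMap, smul_eq_zero_iff_right hc,
    ← heisPolyEquiv_apply, LinearEquiv.map_eq_zero_iff] at hw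
  refine ⟨g.coeff 0, ?_⟩
  rw [heisPolyEquiv_apply, ← heisPolyMap_one, ← map_smul,
    eq_C_of_natDegree_eq_zero (derivative_eq_zero.1 hw), coeff_C_zero,
    C_eq_algebraMap, Algebra.algebraMap_eq_smul_one]

theorem isWhittakerModule_heisWhittaker (a c : ℂ) :
    IsWhittakerModule heisPlus (heisChar a c) (HeisWhittaker a c) :=
  ⟨InducedModule.gen _ _, ⟨heisWhittaker_gen_ne_zero, InducedModule.lie_gen _ _⟩,
    InducedModule.lieSpan_gen _ _⟩

instance : Nontrivial (HeisWhittaker a c) := ⟨_, _, heisWhittaker_gen_ne_zero⟩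

/-- For `c ≠ 0` the operator `p - a` carries any nonzero vector, after finitely many steps, to a
nonzero multiple of the generator, so `M_𝔥(a, c)` is simple. -/
theorem isIrreducible_heisWhittaker (a : ℂ) {c : ℂ} (hc : c ≠ 0) :
    LieModule.IsIrreducible ℂ heis (HeisWhittaker a c) := by
  refine LieModule.IsIrreducible.mk fun N hN => ?_
  obtain ⟨w, hwN, hw⟩ := (Submodule.ne_bot_iff N.toSubmodule).1
    (mt (LieSubmodule.toSubmodule_eq_bot N).1 hN)
  have hpow : ∀ k, (heisLowering a c ^ k) w ∈ N := by
    intro k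
    induction k with
    | zero => exact hwN
    | succ k ih =>
      rw [pow_succ', Module.End.mul_apply, heisLowering_apply]
      exact N.sub_mem (N.lie_mem ih) (N.smul_mem _ ih)
  obtain ⟨k, hk0, hk1⟩ := Module.End.exists_pow_ne_zero_of_locallyNilpotent _
    heisLowering_locallyNilpotent hw
  obtain ⟨t, ht⟩ := heisLowering_ker hc _ hk1
  have ht0 : t ≠ 0 := by
    rintro rfl
    exact hk0 (by rw [ht, zero_smul])
  refine LieSubmodule.eq_top_of_mem_of_lieSpan_eq_top (InducedModule.lieSpan_gen _ _) N ?_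
  rw [← inv_smul_smul₀ ht0 (InducedModule.gen _ _), ← ht]
  exact N.smul_mem _ (hpow k)

end HeisModel

/-! ### The action of the Schrödinger algebra on the Heisenberg Whittaker module -/

section HeisWhittakerS

variable {a c : ℂ} (hc : c ≠ 0)

theorem locAct_toLoc (u : UHeis) : locAct a hc (toLoc u) = uAct heis (HeisWhittaker a c) u :=
  OreLocalization.universalHom_commutes _ _ _

theorem locAct_zInv : locAct a hc zInv = c⁻¹ • 1 := by
  have hz : locAct a hc (toLoc zU) = c • 1 := by
    rw [locAct_toLoc]
    ext v
    rw [uAct_ι, zH_lie]; rfl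
  have h := congrArg (locAct a hc) zInv_mul
  rw [map_mul, hz, map_one, mul_smul_comm, mul_one] at h
  rw [← h, smul_smul, inv_mul_cancel₀ hc, one_smul]

theorem rep_eq_oscillator :
    HeisWhittakerS.rep a c hc =
      oscillator (LieModule.toEnd ℂ heis (HeisWhittaker a c)) hc toEnd_zH := by
  have hι : ∀ x : heis, locAct a hc (toLoc (UniversalEnvelopingAlgebra.ι ℂ x)) =
      LieModule.toEnd ℂ heis (HeisWhittaker a c) x := fun x => by
    rw [locAct_toLoc]; ext v; exact uAct_ι x v
  ext1 x
  have hΦ : Phi (UniversalEnvelopingAlgebra.ι ℂ x) = x 0 • phiE + x 1 • phiH + x 2 • phiF +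
      x 3 • pL + x 4 • qL + x 5 • zL := by
    rw [Phi, UniversalEnvelopingAlgebra.lift_ι_apply]; rfl
  change locAct a hc (Phi (UniversalEnvelopingAlgebra.ι ℂ x)) = _
  rw [hΦ, oscillator_apply]
  simp only [map_add, map_smul, phiE, phiH, phiF, map_sub, map_neg, map_mul, map_pow, map_one,
    locAct_zInv, hι, smul_mul_assoc, one_mul, toEnd_zH]

/-- The identity map from `M_𝔥(a, c)` to the `𝔖`-module `M_𝔥^𝔖(a, c)` on the same space. -/
noncomputable def HeisWhittakerS.of : HeisWhittaker a c ≃ₗ[ℂ] HeisWhittakerS a c hc :=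
  LinearEquiv.refl ℂ (HeisWhittaker a c)

theorem HeisWhittakerS.lie_of (x : Schrodinger) (w : HeisWhittaker a c) :
    ⁅x, of hc w⁆ =
      of hc (oscillator (LieModule.toEnd ℂ heis (HeisWhittaker a c)) hc toEnd_zH x w) := by
  rw [← rep_eq_oscillator]; rfl

end HeisWhittakerS

end Schrodinger

/-! ### Tensor products of the Heisenberg Whittaker module with `sl₂`-modules -/

namespace Schrodinger

namespace Sl2Inflation

/-- The identity map from an `sl₂`-module `M` to the `𝔖`-module `M^𝔖` on the same space. -/
def of (M : Type*) [AddCommGroup M] [Module ℂ M] : M ≃ₗ[ℂ] Sl2Inflation M :=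
  LinearEquiv.refl ℂ M

variable {M M' : Type*} [AddCommGroup M] [Module ℂ M] [LieRingModule sl2 M]
  [AddCommGroup M'] [Module ℂ M'] [LieRingModule sl2 M']

theorem lie_of (x : Schrodinger) (m : M) : ⁅x, of M m⁆ = of M ⁅toSl2 x, m⁆ := rfl

/-- A homomorphism of `sl₂`-modules as a homomorphism of `𝔖`-modules. -/
def map [LieModule ℂ sl2 M] [LieModule ℂ sl2 M'] (T : M →ₗ⁅ℂ,sl2⁆ M') : Sl2Inflation M →ₗ⁅ℂ,Schrodinger⁆ Sl2Inflation M' where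
  toLinearMap := (T : M →ₗ[ℂ] M')
  map_lie' := fun {x m} => T.map_lie (toSl2 x) m

end Sl2Inflation

theorem toSl2_heis (x : heis) : toSl2 (x : Schrodinger) = 0 := by
  obtain ⟨x, h0, h1, h2⟩ := x
  apply Subtype.ext
  apply ext6 <;> simp [toSl2, h0, h1, h2]

theorem toSl2_sl2 (x : sl2) : toSl2 (x : Schrodinger) = x := by
  obtain ⟨x, h3, h4, h5⟩ := x
  apply Subtype.ext
  apply ext6 <;> simp [toSl2, h3, h4, h5]

section Tensor

variable {a c : ℂ} (hc : c ≠ 0) {M M' : Type*} [AddCommGroup M] [Module ℂ M]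
  [AddCommGroup M'] [Module ℂ M']

/-- Pure tensors of `M_𝔥^𝔖 ⊗ M^𝔖`, as a bilinear map on the underlying spaces. -/
noncomputable def pureTensor (M : Type*) [AddCommGroup M] [Module ℂ M] :
    HeisWhittaker a c →ₗ[ℂ] M →ₗ[ℂ] HeisWhittakerS a c hc ⊗[ℂ] Sl2Inflation M :=
  (TensorProduct.mk ℂ (HeisWhittakerS a c hc) (Sl2Inflation M)).compl₁₂
    (HeisWhittakerS.of hc).toLinearMap (Sl2Inflation.of M).toLinearMap

theorem pureTensor_eq (w : HeisWhittaker a c) (m : M) :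
    pureTensor hc M w m = HeisWhittakerS.of hc w ⊗ₜ Sl2Inflation.of M m := rfl

/-- Induction on elements of `M_𝔥^𝔖 ⊗ M^𝔖`. -/
theorem pureTensor_induction {motive : HeisWhittakerS a c hc ⊗[ℂ] Sl2Inflation M → Prop}
    (zero : motive 0) (tmul : ∀ w m, motive (pureTensor hc M w m))
    (add : ∀ t₁ t₂, motive t₁ → motive t₂ → motive (t₁ + t₂))
    (t : HeisWhittakerS a c hc ⊗[ℂ] Sl2Inflation M) : motive t :=
  TensorProduct.induction_on t zero
    (fun w m => tmul ((HeisWhittakerS.of hc).symm w) ((Sl2Inflation.of M).symm m)) add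

theorem pureTensor_gen_eq_zero {m : M}
    (h : pureTensor hc M (InducedModule.gen heisPlus (heisChar a c)) m = 0) : m = 0 :=
  TensorProduct.eq_zero_of_tmul_eq_zero (M := Sl2Inflation M)
    (g := HeisWhittakerS.of hc (InducedModule.gen heisPlus (heisChar a c)))
    ((HeisWhittakerS.of hc).map_ne_zero_iff.2 heisWhittaker_gen_ne_zero) h

variable [LieRingModule sl2 M] [LieModule ℂ sl2 M] [LieRingModule sl2 M'] [LieModule ℂ sl2 M']

theorem lie_pureTensor (x : Schrodinger) (w : HeisWhittaker a c) (m : M) :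
    ⁅x, pureTensor hc M w m⁆ = pureTensor hc M
      (oscillator (LieModule.toEnd ℂ heis (HeisWhittaker a c)) hc toEnd_zH x w) m +
        pureTensor hc M w ⁅toSl2 x, m⁆ := by
  rw [pureTensor_eq, TensorProduct.LieModule.lie_tmul_right, HeisWhittakerS.lie_of,
    Sl2Inflation.lie_of]
  rfl

theorem heis_lie_pureTensor (x : heis) (w : HeisWhittaker a c) (m : M) :
    ⁅(x : Schrodinger), pureTensor hc M w m⁆ = pureTensor hc M ⁅x, w⁆ m := by
  rw [lie_pureTensor, toSl2_heis, zero_lie, map_zero, add_zero, oscillator_heis]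
  rfl

/-- As `𝔥` kills `M^𝔖`, a submodule of `M_𝔥^𝔖 ⊗ M^𝔖` that contains `gen ⊗ m` contains
`M_𝔥^𝔖 ⊗ m`. -/
theorem pureTensor_mem_of_gen
    (N : LieSubmodule ℂ Schrodinger (HeisWhittakerS a c hc ⊗[ℂ] Sl2Inflation M))
    {m : M} (hm : pureTensor hc M (InducedModule.gen heisPlus (heisChar a c)) m ∈ N)
    (w : HeisWhittaker a c) : pureTensor hc M w m ∈ N := by
  let N' : LieSubmodule ℂ heis (HeisWhittaker a c) :=
    { N.toSubmodule.comap ((pureTensor hc M).flip m) with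
      lie_mem := fun {x w} h => by
        have h' : ⁅(x : Schrodinger), pureTensor hc M w m⁆ ∈ N := N.lie_mem h
        rwa [heis_lie_pureTensor] at h' }
  have hN' : N' = ⊤ :=
    LieSubmodule.eq_top_of_mem_of_lieSpan_eq_top (InducedModule.lieSpan_gen _ _) N' hm
  exact (hN' ▸ LieSubmodule.mem_top w : w ∈ N')

/-- The vectors `m` of `M` such that `gen ⊗ m` lies in a given submodule `N` of
`M_𝔥^𝔖 ⊗ M^𝔖`. They form a submodule of `M`. -/
noncomputable def sl2Section
    (N : LieSubmodule ℂ Schrodinger (HeisWhittakerS a c hc ⊗[ℂ] Sl2Inflation M)) :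
    LieSubmodule ℂ sl2 M :=
  { N.toSubmodule.comap (pureTensor hc M (InducedModule.gen heisPlus (heisChar a c))) with
    lie_mem := fun {x m} h => by
      have h' : ⁅(x : Schrodinger),
          pureTensor hc M (InducedModule.gen heisPlus (heisChar a c)) m⁆ ∈ N := N.lie_mem h
      rw [lie_pureTensor, toSl2_sl2] at h'
      exact (N.toSubmodule.add_mem_iff_right (pureTensor_mem_of_gen hc N h _)).1 h' }

theorem mem_sl2Section
    (N : LieSubmodule ℂ Schrodinger (HeisWhittakerS a c hc ⊗[ℂ] Sl2Inflation M)) (m : M) :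
    m ∈ sl2Section hc N ↔
      pureTensor hc M (InducedModule.gen heisPlus (heisChar a c)) m ∈ N := Iff.rfl

theorem sl2Section_top :
    sl2Section hc (⊤ : LieSubmodule ℂ Schrodinger
      (HeisWhittakerS a c hc ⊗[ℂ] Sl2Inflation M)) = ⊤ :=
  rfl

theorem sl2Section_bot :
    sl2Section hc (⊥ : LieSubmodule ℂ Schrodinger
      (HeisWhittakerS a c hc ⊗[ℂ] Sl2Inflation M)) = ⊥ :=
  le_bot_iff.1 fun _ hm => (LieSubmodule.mem_bot _).2
    (pureTensor_gen_eq_zero hc ((LieSubmodule.mem_bot _).1 ((mem_sl2Section hc ⊥ _).1 hm)))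

theorem eq_top_of_sl2Section_eq_top
    (N : LieSubmodule ℂ Schrodinger (HeisWhittakerS a c hc ⊗[ℂ] Sl2Inflation M))
    (h : sl2Section hc N = ⊤) : N = ⊤ := by
  rw [eq_top_iff]
  intro t _
  induction t using pureTensor_induction hc with
  | zero => exact N.zero_mem
  | tmul w m =>
    exact pureTensor_mem_of_gen hc N
      ((mem_sl2Section hc N m).1 (h ▸ LieSubmodule.mem_top m)) w
  | add t₁ t₂ h₁ h₂ => exact N.add_mem (h₁ trivial) (h₂ trivial)

/-- A nonzero submodule of `M_𝔥^𝔖 ⊗ M^𝔖` contains a nonzero vector `gen ⊗ m`, found by applying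
powers of `p - a`. -/
theorem eq_bot_of_sl2Section_eq_bot
    (N : LieSubmodule ℂ Schrodinger (HeisWhittakerS a c hc ⊗[ℂ] Sl2Inflation M))
    (h : sl2Section hc N = ⊥) : N = ⊥ := by
  by_contra hN
  obtain ⟨t, htN, ht⟩ := (Submodule.ne_bot_iff N.toSubmodule).1
    (mt (LieSubmodule.toSubmodule_eq_bot N).1 hN)
  let D : Module.End ℂ (HeisWhittakerS a c hc) :=
    (HeisWhittakerS.of hc).conj (heisLowering a c)
  have hD : ∀ t : HeisWhittakerS a c hc ⊗[ℂ] Sl2Inflation M,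
      D.rTensor (Sl2Inflation M) t = ⁅p, t⁆ - a • t := by
    intro t
    induction t using pureTensor_induction hc with
    | zero => rw [map_zero, lie_zero, smul_zero, sub_zero]
    | tmul w m =>
      rw [show p = ((pH : heis) : Schrodinger) from rfl, heis_lie_pureTensor,
        ← LinearMap.smul_apply, ← map_smul, ← LinearMap.sub_apply, ← map_sub]
      rfl
    | add t₁ t₂ h₁ h₂ => rw [map_add, h₁, h₂, lie_add, smul_add, add_sub_add_comm]
  have hpow : ∀ k, ((D.rTensor (Sl2Inflation M)) ^ k) t ∈ N := by
    intro k
    induction k with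
    | zero => exact htN
    | succ k ih =>
      rw [pow_succ', Module.End.mul_apply, hD]
      exact N.sub_mem (N.lie_mem ih) (N.smul_mem _ ih)
  obtain ⟨k, m, hm, hk⟩ := TensorProduct.exists_rTensor_pow_eq_tmul (M := Sl2Inflation M) D
    heisLowering_locallyNilpotent
    (HeisWhittakerS.of hc (InducedModule.gen heisPlus (heisChar a c))) (heisLowering_ker hc) ht
  obtain ⟨m, rfl⟩ := (Sl2Inflation.of M).surjective m
  have hmem : m ∈ sl2Section hc N := by
    rw [mem_sl2Section, pureTensor_eq, ← hk]
    exact hpow k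
  rw [h, LieSubmodule.mem_bot] at hmem
  exact hm (by rw [hmem, map_zero])

/-- The map of `𝔖`-modules `M_𝔥^𝔖 ⊗ M^𝔖 → M_𝔥^𝔖 ⊗ M'^𝔖` induced by a map of `sl₂`-modules. -/
noncomputable def tensorMap (T : M →ₗ⁅ℂ,sl2⁆ M') :
    HeisWhittakerS a c hc ⊗[ℂ] Sl2Inflation M →ₗ⁅ℂ,Schrodinger⁆
      HeisWhittakerS a c hc ⊗[ℂ] Sl2Inflation M' :=
  TensorProduct.LieModule.map LieModuleHom.id (Sl2Inflation.map T)

theorem tensorMap_pureTensor (T : M →ₗ⁅ℂ,sl2⁆ M') (w : HeisWhittaker a c) (m : M) :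
    tensorMap hc T (pureTensor hc M w m) = pureTensor hc M' w (T m) := rfl

/-- Isomorphic `sl₂`-modules have isomorphic tensor products with `M_𝔥^𝔖`. -/
noncomputable def tensorCongr (E : M ≃ₗ⁅ℂ,sl2⁆ M') :
    HeisWhittakerS a c hc ⊗[ℂ] Sl2Inflation M ≃ₗ⁅ℂ,Schrodinger⁆
      HeisWhittakerS a c hc ⊗[ℂ] Sl2Inflation M' where
  toLieModuleHom := tensorMap hc (E : M →ₗ⁅ℂ,sl2⁆ M')
  invFun := tensorMap hc (E.symm : M' →ₗ⁅ℂ,sl2⁆ M)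
  left_inv t := by
    change tensorMap hc (E.symm : M' →ₗ⁅ℂ,sl2⁆ M) (tensorMap hc (E : M →ₗ⁅ℂ,sl2⁆ M') t) = t
    induction t using pureTensor_induction hc with
    | zero => rw [map_zero, map_zero]
    | tmul w m =>
      rw [tensorMap_pureTensor, tensorMap_pureTensor]
      exact congrArg (pureTensor hc M w) (E.symm_apply_apply m)
    | add t₁ t₂ h₁ h₂ => rw [map_add, map_add, h₁, h₂]
  right_inv t := by
    change tensorMap hc (E : M →ₗ⁅ℂ,sl2⁆ M') (tensorMap hc (E.symm : M' →ₗ⁅ℂ,sl2⁆ M) t) = t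
    induction t using pureTensor_induction hc with
    | zero => rw [map_zero, map_zero]
    | tmul w m =>
      rw [tensorMap_pureTensor, tensorMap_pureTensor]
      exact congrArg (pureTensor hc M' w) (E.apply_symm_apply m)
    | add t₁ t₂ h₁ h₂ => rw [map_add, map_add, h₁, h₂]

/-- Every submodule `M₁` of `M` is the section of the kernel of
`M_𝔥^𝔖 ⊗ M^𝔖 → M_𝔥^𝔖 ⊗ (M / M₁)^𝔖`. -/
theorem sl2Section_ker_tensorMap (M₁ : LieSubmodule ℂ sl2 M) :
    sl2Section hc (tensorMap (a := a) hc (LieSubmodule.Quotient.mk' M₁)).ker = M₁ := by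
  ext m
  rw [mem_sl2Section, LieModuleHom.mem_ker, tensorMap_pureTensor,
    ← LieSubmodule.Quotient.mk_eq_zero (N := M₁)]
  exact ⟨pureTensor_gen_eq_zero hc, fun h => by rw [h, map_zero]⟩

/-- `M_𝔥^𝔖 ⊗ M^𝔖` is simple exactly when `M` is. -/
theorem isIrreducible_tensor_iff (a : ℂ) (M : Type*) [AddCommGroup M] [Module ℂ M]
    [LieRingModule sl2 M] [LieModule ℂ sl2 M] :
    LieModule.IsIrreducible ℂ Schrodinger (HeisWhittakerS a c hc ⊗[ℂ] Sl2Inflation M) ↔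
      LieModule.IsIrreducible ℂ sl2 M := by
  constructor
  · intro h
    refine { exists_pair_ne := ⟨⊥, ⊤, fun hbt => ?_⟩, eq_bot_or_eq_top := fun M₁ => ?_ }
    · exact bot_ne_top
        (eq_top_of_sl2Section_eq_top (a := a) (M := M) hc ⊥ ((sl2Section_bot hc).trans hbt))
    · rw [← sl2Section_ker_tensorMap (a := a) hc M₁]
      obtain h' | h' := h.eq_bot_or_eq_top
        (tensorMap (a := a) hc (LieSubmodule.Quotient.mk' M₁)).ker
      · exact Or.inl (by rw [h', sl2Section_bot])
      · exact Or.inr (by rw [h', sl2Section_top])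
  · intro h
    refine { exists_pair_ne := ⟨⊥, ⊤, fun hbt => ?_⟩, eq_bot_or_eq_top := fun N => ?_ }
    · exact bot_ne_top (α := LieSubmodule ℂ sl2 M)
        (by rw [← sl2Section_bot (a := a) hc, hbt, sl2Section_top])
    · exact (h.eq_bot_or_eq_top (sl2Section hc N)).imp (eq_bot_of_sl2Section_eq_bot hc N)
        (eq_top_of_sl2Section_eq_top hc N)

/-- If `gen ⊗ m` is cyclic in `M_𝔥^𝔖 ⊗ M^𝔖`, then `m` is cyclic in `M`. -/
theorem lieSpan_eq_top_of_pureTensor_gen {m : M} (h : LieSubmodule.lieSpan ℂ Schrodinger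
      {pureTensor hc M (InducedModule.gen heisPlus (heisChar a c)) m} = ⊤) :
    LieSubmodule.lieSpan ℂ sl2 {m} = ⊤ := by
  have hker := sl2Section_ker_tensorMap (a := a) hc (LieSubmodule.lieSpan ℂ sl2 {m})
  have hmem : m ∈ sl2Section hc (tensorMap (a := a) hc
      (LieSubmodule.Quotient.mk' (LieSubmodule.lieSpan ℂ sl2 {m}))).ker := by
    rw [hker]
    exact LieSubmodule.subset_lieSpan (Set.mem_singleton m)
  rw [← hker, LieSubmodule.eq_top_of_mem_of_lieSpan_eq_top h _ ((mem_sl2Section hc _ m).1 hmem),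
    sl2Section_top]

end Tensor

end Schrodinger

/-! ### The Casimir element -/

namespace Schrodinger

section Casimir

theorem sl2_relations : ⁅h2, e2⁆ = (2 : ℂ) • e2 ∧ ⁅h2, f2⁆ = (-2 : ℂ) • f2 ∧ ⁅e2, f2⁆ = h2 :=
  ⟨Subtype.ext relations.1, Subtype.ext relations.2.1, Subtype.ext relations.2.2.1⟩

theorem sl2_eq (x : sl2) :
    x = (x : Schrodinger) 0 • e2 + (x : Schrodinger) 1 • h2 + (x : Schrodinger) 2 • f2 := by
  obtain ⟨x, h3, h4, h5⟩ := x
  apply Subtype.ext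
  apply ext6 <;> simp [e2, h2, f2, e, h, f, h3, h4, h5]

variable {V : Type*} [AddCommGroup V] [LieRingModule sl2 V]

theorem e2_lie_f2_lie (v : V) : ⁅e2, ⁅f2, v⁆⁆ = ⁅h2, v⁆ + ⁅f2, ⁅e2, v⁆⁆ := by
  rw [leibniz_lie, sl2_relations.2.2]

variable [Module ℂ V] [LieModule ℂ sl2 V]

theorem uAct_casimir (v : V) :
    uAct sl2 V casimir v = (4 : ℂ) • ⁅f2, ⁅e2, v⁆⁆ + (2 : ℂ) • ⁅h2, v⁆ + ⁅h2, ⁅h2, v⁆⁆ := by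
  have h4 : (4 : UniversalEnvelopingAlgebra ℂ sl2) = algebraMap ℂ _ 4 := (map_ofNat _ 4).symm
  have h2' : (2 : UniversalEnvelopingAlgebra ℂ sl2) = algebraMap ℂ _ 2 := (map_ofNat _ 2).symm
  rw [casimir, pow_two, h4, h2']
  simp only [map_add, map_mul, AlgHom.commutes, LinearMap.add_apply, Module.End.mul_apply, uAct_ι,
    Module.algebraMap_end_apply]

theorem h2_lie_e2_lie (v : V) : ⁅h2, ⁅e2, v⁆⁆ = (2 : ℂ) • ⁅e2, v⁆ + ⁅e2, ⁅h2, v⁆⁆ := by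
  rw [leibniz_lie, sl2_relations.1, smul_lie]

theorem h2_lie_f2_lie (v : V) : ⁅h2, ⁅f2, v⁆⁆ = (-2 : ℂ) • ⁅f2, v⁆ + ⁅f2, ⁅h2, v⁆⁆ := by
  rw [leibniz_lie, sl2_relations.2.1, smul_lie]

/-- The Casimir element acts on every `sl₂`-module by an endomorphism of the module. -/
noncomputable def casimirHom (V : Type*) [AddCommGroup V] [Module ℂ V] [LieRingModule sl2 V]
    [LieModule ℂ sl2 V] : V →ₗ⁅ℂ,sl2⁆ V where
  toLinearMap := uAct sl2 V casimir
  map_lie' := by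
    intro x v
    change uAct sl2 V casimir ⁅x, v⁆ = ⁅x, uAct sl2 V casimir v⁆
    have he : uAct sl2 V casimir ⁅e2, v⁆ = ⁅e2, uAct sl2 V casimir v⁆ := by
      simp only [uAct_casimir, lie_add, lie_smul, h2_lie_e2_lie, e2_lie_f2_lie]
      module
    have hh : uAct sl2 V casimir ⁅h2, v⁆ = ⁅h2, uAct sl2 V casimir v⁆ := by
      simp only [uAct_casimir, lie_add, lie_smul, h2_lie_e2_lie, h2_lie_f2_lie]
      module
    have hf : uAct sl2 V casimir ⁅f2, v⁆ = ⁅f2, uAct sl2 V casimir v⁆ := by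
      simp only [uAct_casimir, lie_add, lie_smul, h2_lie_f2_lie, e2_lie_f2_lie]
      module
    conv_lhs => rw [sl2_eq x]
    conv_rhs => rw [sl2_eq x]
    simp only [add_lie, smul_lie, map_add, map_smul, he, hh, hf]

theorem casimirHom_apply (v : V) : casimirHom V v = uAct sl2 V casimir v := rfl

/-- A cyclic `sl₂`-module is spanned by the countable set of all words in `e`, `h`, `f` applied to
the cyclic vector. -/
theorem exists_countable_span_eq_top {v : V} (hv : LieSubmodule.lieSpan ℂ sl2 {v} = ⊤) :
    ∃ S : Set V, S.Countable ∧ Submodule.span ℂ S = ⊤ := by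
  let word : List (Fin 3) → V := fun l => l.foldr (fun i w => ⁅(![e2, h2, f2] : Fin 3 → sl2) i, w⁆) v
  have hword : ∀ i l, ⁅(![e2, h2, f2] : Fin 3 → sl2) i, word l⁆ = word (i :: l) := fun _ _ => rfl
  have hstep : ∀ i, ∀ w ∈ Submodule.span ℂ (Set.range word),
      ⁅(![e2, h2, f2] : Fin 3 → sl2) i, w⁆ ∈ Submodule.span ℂ (Set.range word) := by
    intro i w hw
    induction hw using Submodule.span_induction with
    | mem w hw =>
      obtain ⟨l, rfl⟩ := hw
      rw [hword]
      exact Submodule.subset_span ⟨_, rfl⟩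
    | zero => rw [lie_zero]; exact Submodule.zero_mem _
    | add w₁ w₂ _ _ h₁ h₂ => rw [lie_add]; exact Submodule.add_mem _ h₁ h₂
    | smul t w _ hw => rw [lie_smul]; exact Submodule.smul_mem _ t hw
  let N : LieSubmodule ℂ sl2 V :=
    { Submodule.span ℂ (Set.range word) with
      lie_mem := fun {x w} hw => by
        change ⁅x, w⁆ ∈ Submodule.span ℂ (Set.range word)
        rw [sl2_eq x, add_lie, add_lie, smul_lie, smul_lie, smul_lie]
        exact Submodule.add_mem _ (Submodule.add_mem _ (Submodule.smul_mem _ _ (hstep 0 w hw))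
          (Submodule.smul_mem _ _ (hstep 1 w hw))) (Submodule.smul_mem _ _ (hstep 2 w hw)) }
  refine ⟨Set.range word, Set.countable_range word, ?_⟩
  have hN : N = ⊤ := LieSubmodule.eq_top_of_mem_of_lieSpan_eq_top hv N
    (Submodule.subset_span ⟨[], rfl⟩)
  exact congrArg LieSubmodule.toSubmodule hN

/-- The Casimir element acts by a scalar on a simple `sl₂`-module: the module has countable
dimension, so some `Ω - c` is not bijective, and by Schur's lemma it is zero. -/
theorem exists_casimir_eq_smul (hV : LieModule.IsIrreducible ℂ sl2 V) :
    ∃ c : ℂ, ∀ v : V, uAct sl2 V casimir v = c • v := by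
  have := LieModule.nontrivial_of_isIrreducible ℂ sl2 V
  obtain ⟨v, hv⟩ := exists_ne (0 : V)
  obtain ⟨S, hS, hspan⟩ := exists_countable_span_eq_top (hV.lieSpan_singleton_eq_top hv)
  obtain ⟨c, hc⟩ := Module.End.exists_not_bijective_sub (uAct sl2 V casimir) hS hspan
  let T : V →ₗ⁅ℂ,sl2⁆ V := casimirHom V - c • LieModuleHom.id
  refine ⟨c, fun w => sub_eq_zero.1 ?_⟩
  change T w = 0
  by_contra hw
  have hker : T.ker = ⊥ := (hV.eq_bot_or_eq_top _).resolve_right fun h =>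
    hw (LieModuleHom.mem_ker.1 (h ▸ LieSubmodule.mem_top w))
  have hrange : T.range = ⊤ := (hV.eq_bot_or_eq_top _).resolve_left fun h =>
    hw ((LieSubmodule.mem_bot (T w)).1 (h ▸ (T.mem_range (T w)).2 ⟨w, rfl⟩))
  exact hc ⟨T.ker_eq_bot.1 hker, T.range_eq_top.1 hrange⟩

end Casimir

/-! ### Nondegenerate Whittaker modules for `sl₂` -/

section Sl2Model

open Polynomial

/-- The operator `g(X) ↦ a g(X - 2)`, by which `e` acts on `ℂ[X]`. -/
noncomputable def sl2PolyE (a : ℂ) : Module.End ℂ ℂ[X] := a • taylor (-2)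

/-- The operator `g(X) ↦ (c - 2X - X²) g(X + 2) / 4a`, by which `f` acts on `ℂ[X]`. -/
noncomputable def sl2PolyF (a c : ℂ) : Module.End ℂ ℂ[X] :=
  (4 * a)⁻¹ • (LinearMap.mulLeft ℂ (C c - C 2 * X - X ^ 2)).comp (taylor 2)

variable {a c : ℂ}

theorem sl2PolyE_apply (g : ℂ[X]) : sl2PolyE a g = a • taylor (-2) g := rfl

theorem sl2PolyF_apply (g : ℂ[X]) :
    sl2PolyF a c g = (4 * a)⁻¹ • ((C c - C 2 * X - X ^ 2) * taylor 2 g) := rfl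

theorem taylor_neg_two_taylor_two (g : ℂ[X]) : taylor (-2) (taylor 2 g) = g := by
  rw [taylor_taylor, neg_add_cancel, taylor_zero]

theorem taylor_two_taylor_neg_two (g : ℂ[X]) : taylor 2 (taylor (-2) g) = g := by
  rw [taylor_taylor, add_neg_cancel, taylor_zero]

theorem sl2PolyF_sl2PolyE (ha : a ≠ 0) (g : ℂ[X]) :
    sl2PolyF a c (sl2PolyE a g) = (4 : ℂ)⁻¹ • ((C c - C 2 * X - X ^ 2) * g) := by
  rw [sl2PolyE_apply, map_smul, sl2PolyF_apply, taylor_two_taylor_neg_two, smul_smul,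
    mul_inv, mul_comm, mul_assoc, inv_mul_cancel₀ ha, mul_one]

theorem sl2PolyE_sl2PolyF (ha : a ≠ 0) (g : ℂ[X]) :
    sl2PolyE a (sl2PolyF a c g) = (4 : ℂ)⁻¹ • ((C c - C 2 * (X - C 2) - (X - C 2) ^ 2) * g) := by
  rw [sl2PolyF_apply, map_smul, sl2PolyE_apply, taylor_mul, taylor_neg_two_taylor_two, smul_smul,
    mul_inv, mul_assoc, inv_mul_cancel₀ ha, mul_one]
  congr 2
  simp only [map_sub, taylor_mul, taylor_pow, taylor_X, taylor_C, map_neg]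
  ring

/-- The representation of `sl₂` on `ℂ[X]`, `a ≠ 0`, in which `h` acts as multiplication by `X`,
`e` as `g(X) ↦ a g(X - 2)` and `Ω` as the scalar `c`. -/
noncomputable def sl2PolyRep (ha : a ≠ 0) (c : ℂ) : sl2 →ₗ⁅ℂ⁆ Module.End ℂ ℂ[X] :=
  (liftRel (sl2PolyE a) (LinearMap.mulLeft ℂ X) (sl2PolyF a c) 0 0 0
    (by
      refine LinearMap.ext fun g => ?_
      simp only [LieRing.of_associative_ring_bracket, LinearMap.sub_apply, Module.End.mul_apply,
        LinearMap.smul_apply, LinearMap.mulLeft_apply, sl2PolyE_apply, taylor_mul,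
        taylor_X, map_neg, smul_eq_C_mul]
      ring)
    (by
      refine LinearMap.ext fun g => ?_
      simp only [LieRing.of_associative_ring_bracket, LinearMap.sub_apply, Module.End.mul_apply,
        LinearMap.smul_apply, LinearMap.mulLeft_apply, sl2PolyF_apply, taylor_mul,
        taylor_X, map_neg, smul_eq_C_mul]
      ring)
    (by
      refine LinearMap.ext fun g => ?_
      simp only [LieRing.of_associative_ring_bracket, LinearMap.sub_apply, Module.End.mul_apply,
        sl2PolyE_sl2PolyF ha, sl2PolyF_sl2PolyE ha, LinearMap.mulLeft_apply, ← smul_sub]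
      rw [inv_smul_eq_iff₀ (by norm_num : (4 : ℂ) ≠ 0), smul_eq_C_mul]
      simp only [C_ofNat]
      ring)
    (lie_zero _) ((lie_zero _).trans neg_zero.symm) (lie_zero _) (lie_zero _)
    ((zero_lie _).trans neg_zero.symm) (lie_zero _) (lie_zero _) (zero_lie _) (zero_lie _)
    (zero_lie _) (zero_lie _) (zero_lie _)).comp sl2.incl

theorem sl2PolyRep_apply (ha : a ≠ 0) (x : sl2) (g : ℂ[X]) :
    sl2PolyRep ha c x g = (x : Schrodinger) 0 • sl2PolyE a g + (x : Schrodinger) 1 • (X * g) +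
      (x : Schrodinger) 2 • sl2PolyF a c g := by
  have h : sl2PolyRep ha c x = (x : Schrodinger) 0 • sl2PolyE a +
      (x : Schrodinger) 1 • LinearMap.mulLeft ℂ X + (x : Schrodinger) 2 • sl2PolyF a c +
      (x : Schrodinger) 3 • 0 + (x : Schrodinger) 4 • 0 + (x : Schrodinger) 5 • 0 := rfl
  rw [h]
  simp only [smul_zero, add_zero]
  rfl

theorem sl2PolyRep_e2 (ha : a ≠ 0) (g : ℂ[X]) : sl2PolyRep ha c e2 g = sl2PolyE a g := by
  rw [sl2PolyRep_apply]; simp [e2, e]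

theorem sl2PolyRep_h2 (ha : a ≠ 0) (g : ℂ[X]) : sl2PolyRep ha c h2 g = X * g := by
  rw [sl2PolyRep_apply]; simp [h2, h]

theorem sl2PolyRep_f2 (ha : a ≠ 0) (g : ℂ[X]) : sl2PolyRep ha c f2 g = sl2PolyF a c g := by
  rw [sl2PolyRep_apply]; simp [f2, f]

theorem sl2PolyE_one : sl2PolyE a 1 = a • 1 := by rw [sl2PolyE_apply, taylor_one, C_1]

/-- The difference operator `g(X) ↦ g(X - 2) - g(X)` lowers degrees, so a nonzero subspace of
`ℂ[X]` that is stable under it and under multiplication by `X` contains a constant and is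
everything. -/
theorem eq_top_of_sl2Poly_stable (ha : a ≠ 0) (N : Submodule ℂ ℂ[X]) (hN : N ≠ ⊥)
    (hX : ∀ g ∈ N, X * g ∈ N) (hE : ∀ g ∈ N, sl2PolyE a g ∈ N) : N = ⊤ := by
  have hstep : ∀ n : ℕ, ∀ g ∈ N, g ≠ 0 → g.natDegree ≤ n → (1 : ℂ[X]) ∈ N := by
    intro n
    induction n with
    | zero =>
      intro g hg hg0 hdeg
      rw [eq_C_of_natDegree_le_zero hdeg] at hg hg0
      have h0 : g.coeff 0 ≠ 0 := fun h => hg0 (by rw [h, C_0])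
      have h1 := N.smul_mem (g.coeff 0)⁻¹ hg
      rwa [smul_C, smul_eq_mul, inv_mul_cancel₀ h0, C_1] at h1
    | succ n ih =>
      intro g hg hg0 hdeg
      by_cases hd : g.natDegree = 0
      · exact ih g hg hg0 (by omega)
      have hmem : taylor (-2) g - g ∈ N := by
        refine N.sub_mem ?_ hg
        have h1 := N.smul_mem a⁻¹ (hE g hg)
        rwa [sl2PolyE_apply, inv_smul_smul₀ ha] at h1
      have hne : taylor (-2) g - g ≠ 0 := by
        -- A nonconstant polynomial of period 2 would take one value infinitely often.
        intro h0
        have hper : ∀ k : ℕ, (g - C (g.eval 0)).eval (-2 * k : ℂ) = 0 := by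
          intro k
          induction k with
          | zero => simp
          | succ k ihk =>
            have h2 := congrArg (eval (-2 * k : ℂ)) (sub_eq_zero.1 h0)
            rw [taylor_eval] at h2
            rwa [Nat.cast_succ, mul_add, mul_one, eval_sub, eval_C, h2, ← eval_C (a := g.eval 0),
              ← eval_sub]
        have hz : g - C (g.eval 0) = 0 := by
          refine eq_zero_of_infinite_isRoot _ (Set.Infinite.mono ?_ (Set.infinite_range_of_injective
            (f := fun k : ℕ => (-2 * k : ℂ)) fun k l hkl => ?_))
          · rintro _ ⟨k, rfl⟩
            exact hper k
          · simpa using hkl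
        exact hd (by rw [sub_eq_zero.1 hz, natDegree_C])
      have hlt : (taylor (-2) g - g).natDegree < g.natDegree := by
        have h2 := natDegree_lt_natDegree hne (degree_sub_lt_left (degree_taylor g (-2))
          (by rwa [ne_eq, taylor_eq_zero]) (leadingCoeff_taylor _ _))
        rwa [natDegree_taylor] at h2
      exact ih _ hmem hne (by omega)
  obtain ⟨g, hg, hg0⟩ := (Submodule.ne_bot_iff N).1 hN
  have h1 := hstep _ g hg hg0 le_rfl
  rw [eq_top_iff]
  intro g _
  induction g using Polynomial.induction_on with
  | C t =>
    rw [C_eq_algebraMap, Algebra.algebraMap_eq_smul_one]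
    exact N.smul_mem t h1
  | add g₁ g₂ h₁ h₂ => exact N.add_mem (h₁ trivial) (h₂ trivial)
  | monomial n t ih =>
    rw [pow_succ', mul_left_comm]
    exact hX _ (ih trivial)

variable {V : Type*} [AddCommGroup V] [Module ℂ V] [LieRingModule sl2 V] [LieModule ℂ sl2 V]

/-- The map `ℂ[X] → V`, `g ↦ g(h) w`. -/
noncomputable def sl2PolyMap (w : V) : ℂ[X] →ₗ[ℂ] V :=
  (LinearMap.applyₗ w).comp (aeval (LieModule.toEnd ℂ sl2 V h2)).toLinearMap

theorem sl2PolyMap_one (w : V) : sl2PolyMap w 1 = w := by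
  change aeval (LieModule.toEnd ℂ sl2 V h2) (1 : ℂ[X]) w = w
  rw [map_one]; rfl

theorem sl2PolyMap_X_mul (w : V) (g : ℂ[X]) : sl2PolyMap w (X * g) = ⁅h2, sl2PolyMap w g⁆ := by
  change aeval (LieModule.toEnd ℂ sl2 V h2) (X * g) w = _
  rw [map_mul, aeval_X]; rfl

theorem e2_lie_sl2PolyMap {w : V} (he : ⁅e2, w⁆ = a • w) (g : ℂ[X]) :
    ⁅e2, sl2PolyMap w g⁆ = sl2PolyMap w (sl2PolyE a g) := by
  induction g using Polynomial.induction_on with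
  | C t =>
    rw [C_eq_algebraMap, Algebra.algebraMap_eq_smul_one, map_smul, map_smul, map_smul, lie_smul,
      sl2PolyE_one, map_smul, sl2PolyMap_one, he]
  | add g₁ g₂ h₁ h₂ => rw [map_add, lie_add, h₁, h₂, ← map_add, map_add (sl2PolyE a)]
  | monomial n t ih =>
    rw [show C t * X ^ (n + 1) = X * (C t * X ^ n) by ring, sl2PolyMap_X_mul,
      ← sub_eq_of_eq_add' (h2_lie_e2_lie _), ih, ← sl2PolyMap_X_mul, ← map_smul, ← map_sub]
    congr 1
    simp only [sl2PolyE_apply, taylor_mul _ X, taylor_X, map_neg, smul_eq_C_mul]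
    ring

theorem casimir_sl2PolyMap {w : V} (hΩ : uAct sl2 V casimir w = c • w) (g : ℂ[X]) :
    uAct sl2 V casimir (sl2PolyMap w g) = c • sl2PolyMap w g := by
  induction g using Polynomial.induction_on with
  | C t =>
    rw [C_eq_algebraMap, Algebra.algebraMap_eq_smul_one, map_smul, map_smul, sl2PolyMap_one, hΩ,
      smul_comm]
  | add g₁ g₂ h₁ h₂ => rw [map_add, map_add, h₁, h₂, smul_add]
  | monomial n t ih =>
    rw [show C t * X ^ (n + 1) = X * (C t * X ^ n) by ring, sl2PolyMap_X_mul, ← casimirHom_apply,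
      LieModuleHom.map_lie, casimirHom_apply, ih, lie_smul]

/-- As `f e = (Ω - 2h - h²) / 4` and `e` is invertible on `ℂ[X]`, the action of `f` is
determined by those of `e`, `h` and `Ω`. -/
theorem sl2PolyMap_intertwine (ha : a ≠ 0) {w : V} (he : ⁅e2, w⁆ = a • w)
    (hΩ : uAct sl2 V casimir w = c • w) (x : sl2) (g : ℂ[X]) :
    sl2PolyMap w (sl2PolyRep ha c x g) = ⁅x, sl2PolyMap w g⁆ := by
  have hf : ⁅f2, sl2PolyMap w g⁆ = sl2PolyMap w (sl2PolyF a c g) := by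
    obtain ⟨g', rfl⟩ : ∃ g', sl2PolyE a g' = g :=
      ⟨a⁻¹ • taylor 2 g, by
        rw [map_smul, sl2PolyE_apply, taylor_neg_two_taylor_two, inv_smul_smul₀ ha]⟩
    rw [sl2PolyF_sl2PolyE ha, map_smul, eq_inv_smul_iff₀ (by norm_num : (4 : ℂ) ≠ 0), ← e2_lie_sl2PolyMap he]
    have h := casimir_sl2PolyMap hΩ g'
    rw [uAct_casimir, add_assoc, ← eq_sub_iff_add_eq, ← sl2PolyMap_X_mul, ← sl2PolyMap_X_mul,
      ← map_smul, ← map_smul, ← map_add, ← map_sub] at h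
    rw [h]
    congr 1
    simp only [smul_eq_C_mul, C_ofNat]
    ring
  conv_rhs => rw [sl2_eq x]
  rw [add_lie, add_lie, smul_lie, smul_lie, smul_lie, e2_lie_sl2PolyMap he, hf, ← sl2PolyMap_X_mul,
    sl2PolyRep_apply]
  simp only [map_add, map_smul]

variable {w : V} (ha : a ≠ 0) (hw : w ≠ 0) (he : ⁅e2, w⁆ = a • w)
  (hΩ : uAct sl2 V casimir w = c • w) (hcyc : LieSubmodule.lieSpan ℂ sl2 {w} = ⊤)

/-- A cyclic `sl₂`-module with a Whittaker vector of type `a ≠ 0` on which `Ω` acts as `c` is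
`ℂ[X]`, through `g ↦ g(h) w`. -/
noncomputable def sl2PolyEquiv : ℂ[X] ≃ₗ[ℂ] V :=
  LinearEquiv.ofBijective (sl2PolyMap w) (by
    constructor
    · rw [← LinearMap.ker_eq_bot]
      by_contra hne
      have htop := eq_top_of_sl2Poly_stable ha _ hne
        (fun g hg => by
          rw [LinearMap.mem_ker] at hg ⊢
          rw [sl2PolyMap_X_mul, hg, lie_zero])
        (fun g hg => by
          rw [LinearMap.mem_ker] at hg ⊢
          rw [← e2_lie_sl2PolyMap he, hg, lie_zero])
      refine hw ?_
      rw [← sl2PolyMap_one w]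
      exact LinearMap.mem_ker.1 (htop ▸ Submodule.mem_top)
    · let N : LieSubmodule ℂ sl2 V :=
        { LinearMap.range (sl2PolyMap w) with
          lie_mem := fun {x v} hv => by
            obtain ⟨g, rfl⟩ := hv
            exact ⟨_, sl2PolyMap_intertwine ha he hΩ x g⟩ }
      have hN : N = ⊤ :=
        LieSubmodule.eq_top_of_mem_of_lieSpan_eq_top hcyc N ⟨1, sl2PolyMap_one w⟩
      exact fun v => (hN ▸ LieSubmodule.mem_top v : v ∈ N))

/-- Nondegenerate cyclic Whittaker `sl₂`-modules with scalar Casimir element are simple. -/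
theorem isIrreducible_of_casimir_eq_smul {w : V} (ha : a ≠ 0) (hw : w ≠ 0) (he : ⁅e2, w⁆ = a • w)
    (hΩ : uAct sl2 V casimir w = c • w) (hcyc : LieSubmodule.lieSpan ℂ sl2 {w} = ⊤) :
    LieModule.IsIrreducible ℂ sl2 V := by
  have : Nontrivial V := ⟨w, 0, hw⟩
  refine LieModule.IsIrreducible.mk fun N hN => ?_
  let E := sl2PolyEquiv ha hw he hΩ hcyc
  obtain ⟨v, hvN, hv⟩ := (Submodule.ne_bot_iff N.toSubmodule).1
    (mt (LieSubmodule.toSubmodule_eq_bot N).1 hN)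
  have htop := eq_top_of_sl2Poly_stable ha (N.toSubmodule.comap E.toLinearMap)
    ((Submodule.ne_bot_iff _).2 ⟨E.symm v, by simpa using hvN, E.symm.map_ne_zero_iff.2 hv⟩)
    (fun g hg => by
      change sl2PolyMap w (X * g) ∈ N
      rw [sl2PolyMap_X_mul]
      exact N.lie_mem hg)
    (fun g hg => by
      change sl2PolyMap w (sl2PolyE a g) ∈ N
      rw [← e2_lie_sl2PolyMap he]
      exact N.lie_mem hg)
  rw [eq_top_iff]
  intro v _
  have hv : E.symm v ∈ N.toSubmodule.comap E.toLinearMap := htop ▸ Submodule.mem_top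
  simpa using hv

end Sl2Model

end Schrodinger

/-! ### The modules `M_{sl₂}(a, c)` -/

namespace Schrodinger

section Sl2Whittaker

variable {a c : ℂ}

theorem isWhittakerVector_sl2_iff {V : Type*} [AddCommGroup V] [Module ℂ V] [LieRingModule sl2 V]
    [LieModule ℂ sl2 V] (w : V) :
    IsWhittakerVector sl2Plus (sl2Char a) w ↔ w ≠ 0 ∧ ⁅e2, w⁆ = a • w := by
  refine and_congr_right fun _ => ⟨fun hx => ?_, fun he x => ?_⟩
  · have hmem : e2 ∈ sl2Plus := by
      change e 1 = 0 ∧ e 2 = 0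
      simp [e]
    have hchar : sl2Char a ⟨e2, hmem⟩ = a := by simp [sl2Char, e2, e]
    rw [← hchar]
    exact hx ⟨e2, hmem⟩
  · have h1 : ((x : sl2) : Schrodinger) 1 = 0 := x.2.1
    have h2 : ((x : sl2) : Schrodinger) 2 = 0 := x.2.2
    have hchar : sl2Char a x = a * ((x : sl2) : Schrodinger) 0 := rfl
    rw [hchar, mul_comm, mul_smul, ← he, ← smul_lie]
    conv_lhs => rw [sl2_eq (x : sl2), h1, h2, zero_smul, zero_smul, add_zero, add_zero]

/-- The image of the generator in `M_{sl₂}(a, c)`. -/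
noncomputable def sl2Gen (a c : ℂ) : sl2Whittaker a c :=
  LieSubmodule.Quotient.mk' (sl2CasimirSubmodule a c) (InducedModule.gen sl2Plus (sl2Char a))

/-- The generator survives in `M_{sl₂}(a, c)`, since it maps to `1` in the polynomial model, in
which `Ω = c`. -/
theorem sl2Gen_ne_zero (ha : a ≠ 0) (c : ℂ) : sl2Gen a c ≠ 0 := by
  rw [sl2Gen, ne_eq, LieSubmodule.Quotient.mk_eq_zero]
  have hv : ∀ x : sl2Plus, sl2PolyRep ha c (x : sl2) 1 = sl2Char a x • (1 : Polynomial ℂ) := by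
    intro x
    have h1 : ((x : sl2) : Schrodinger) 1 = 0 := x.2.1
    have h2 : ((x : sl2) : Schrodinger) 2 = 0 := x.2.2
    have hchar : sl2Char a x = a * ((x : sl2) : Schrodinger) 0 := rfl
    rw [sl2PolyRep_apply, h1, h2, zero_smul, zero_smul, add_zero, add_zero, sl2PolyE_one, hchar,
      smul_smul, mul_comm]
  let T := InducedModule.lift (sl2PolyRep ha c) 1 hv
  let N : LieSubmodule ℂ sl2 (sl2Universal a) :=
    { LinearMap.ker T with
      lie_mem := fun {x w} hw => by
        change T ⁅x, w⁆ = 0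
        rw [InducedModule.lift_lie, show T w = 0 from hw, map_zero] }
  have hle : sl2CasimirSubmodule a c ≤ N := by
    refine LieSubmodule.lieSpan_le.2 (Set.singleton_subset_iff.2 ?_)
    change T _ = 0
    rw [sub_smul, map_sub, ← InducedModule.uAct_eq_smul, uAct_casimir, algebraMap_smul, map_smul]
    simp only [map_add, map_smul, T, InducedModule.lift_lie, InducedModule.lift_gen]
    rw [sl2PolyRep_e2, sl2PolyRep_f2, sl2PolyF_sl2PolyE ha, sl2PolyRep_h2, sl2PolyRep_h2]
    simp only [Polynomial.smul_eq_C_mul, ← mul_assoc, ← Polynomial.C_mul]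
    rw [mul_inv_cancel₀ (by norm_num : (4 : ℂ) ≠ 0), Polynomial.C_1]
    ring
  intro hmem
  have h1 : T (InducedModule.gen sl2Plus (sl2Char a)) = 0 := hle hmem
  rw [InducedModule.lift_gen] at h1
  exact one_ne_zero h1

theorem e2_lie_sl2Gen : ⁅e2, sl2Gen a c⁆ = a • sl2Gen a c := by
  have hmem : e2 ∈ sl2Plus := by
    change e 1 = 0 ∧ e 2 = 0
    simp [e]
  have hchar : sl2Char a ⟨e2, hmem⟩ = a := by simp [sl2Char, e2, e]
  have h := InducedModule.lie_gen sl2Plus (sl2Char a) ⟨e2, hmem⟩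
  rw [hchar] at h
  rw [sl2Gen, ← LieModuleHom.map_lie, h, map_smul]

theorem casimir_sl2Gen : uAct sl2 (sl2Whittaker a c) casimir (sl2Gen a c) = c • sl2Gen a c := by
  rw [sl2Gen, ← LieModuleHom.map_uAct, ← sub_eq_zero, ← map_smul, ← map_sub,
    LieSubmodule.Quotient.mk_eq_zero, InducedModule.uAct_eq_smul,
    ← algebraMap_smul (UniversalEnvelopingAlgebra ℂ sl2) c (InducedModule.gen _ _), ← sub_smul]
  exact LieSubmodule.subset_lieSpan (Set.mem_singleton _)

theorem lieSpan_sl2Gen : LieSubmodule.lieSpan ℂ sl2 {sl2Gen a c} = ⊤ := by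
  have h := LieSubmodule.eq_top_of_mem_of_lieSpan_eq_top
    (InducedModule.lieSpan_gen sl2Plus (sl2Char a))
    ((LieSubmodule.lieSpan ℂ sl2 {sl2Gen a c}).comap
      (LieSubmodule.Quotient.mk' (sl2CasimirSubmodule a c)))
    (LieSubmodule.mem_comap.2 (LieSubmodule.subset_lieSpan (Set.mem_singleton _)))
  rw [eq_top_iff]
  intro v _
  obtain ⟨w, rfl⟩ := LieSubmodule.Quotient.surjective_mk' (sl2CasimirSubmodule a c) v
  exact LieSubmodule.mem_comap.1 (h ▸ LieSubmodule.mem_top w)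

theorem isWhittakerModule_sl2Whittaker (ha : a ≠ 0) (c : ℂ) :
    IsWhittakerModule sl2Plus (sl2Char a) (sl2Whittaker a c) :=
  ⟨sl2Gen a c, (isWhittakerVector_sl2_iff _).2 ⟨sl2Gen_ne_zero ha c, e2_lie_sl2Gen⟩,
    lieSpan_sl2Gen⟩

theorem isIrreducible_sl2Whittaker (ha : a ≠ 0) (c : ℂ) :
    LieModule.IsIrreducible ℂ sl2 (sl2Whittaker a c) :=
  isIrreducible_of_casimir_eq_smul ha (sl2Gen_ne_zero ha c) e2_lie_sl2Gen casimir_sl2Gen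
    lieSpan_sl2Gen

/-- For `a ≠ 0` a Whittaker `sl₂`-module of type `a` on which `Ω` acts as `c` is `M_{sl₂}(a, c)`:
both are the polynomial model. -/
theorem nonempty_equiv_sl2Whittaker (ha : a ≠ 0) {M : Type*} [AddCommGroup M] [Module ℂ M]
    [LieRingModule sl2 M] [LieModule ℂ sl2 M] (hM : IsWhittakerModule sl2Plus (sl2Char a) M)
    (hΩ : ∀ m : M, uAct sl2 M casimir m = c • m) : Nonempty (M ≃ₗ⁅ℂ,sl2⁆ sl2Whittaker a c) := by
  obtain ⟨w, hw, hcyc⟩ := hM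
  obtain ⟨hw0, he⟩ := (isWhittakerVector_sl2_iff w).1 hw
  let E₁ := sl2PolyEquiv ha hw0 he (hΩ w) hcyc
  let E₂ := sl2PolyEquiv ha (sl2Gen_ne_zero ha c) e2_lie_sl2Gen casimir_sl2Gen lieSpan_sl2Gen
  refine ⟨{ (E₁.symm.trans E₂) with map_lie' := fun {x m} => ?_ }⟩
  obtain ⟨g, rfl⟩ := E₁.surjective m
  change E₂ (E₁.symm ⁅x, E₁ g⁆) = ⁅x, E₂ (E₁.symm (E₁ g))⁆
  have h1 : ⁅x, E₁ g⁆ = E₁ (sl2PolyRep ha c x g) := (sl2PolyMap_intertwine ha he (hΩ w) x g).symm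
  rw [h1, E₁.symm_apply_apply, E₁.symm_apply_apply]
  exact sl2PolyMap_intertwine ha e2_lie_sl2Gen casimir_sl2Gen x g

end Sl2Whittaker

/-! ### Decomposition of Whittaker modules for the Schrödinger algebra -/

section Decomposition

variable {W : Type*} [AddCommGroup W] [Module ℂ W] [LieRingModule Schrodinger W]
  [LieModule ℂ Schrodinger W]

/-- The representation of `𝔥` on an `𝔖`-module. -/
noncomputable def heisRep (W : Type*) [AddCommGroup W] [Module ℂ W] [LieRingModule Schrodinger W]
    [LieModule ℂ Schrodinger W] : heis →ₗ⁅ℂ⁆ Module.End ℂ W :=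
  (LieModule.toEnd ℂ Schrodinger W).comp heis.incl

variable {c : ℂ} (hc : c ≠ 0) (hρ : heisRep W zH = c • 1)

/-- The part of the action of `x ∈ 𝔖` on `W` that is not accounted for by `Φ(x)`. -/
noncomputable def residual (x : Schrodinger) : Module.End ℂ W :=
  LieModule.toEnd ℂ Schrodinger W x - oscillator (heisRep W) hc hρ x

theorem lie_eq_oscillator_add_residual (x : Schrodinger) (w : W) :
    ⁅x, w⁆ = oscillator (heisRep W) hc hρ x w + residual hc hρ x w :=
  (add_sub_cancel _ _).symm

theorem residual_heis (x : heis) : residual hc hρ (x : Schrodinger) = 0 := by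
  rw [residual, oscillator_heis]
  exact sub_self _

theorem residual_toSl2 (x : Schrodinger) :
    residual hc hρ (toSl2 x : Schrodinger) = residual hc hρ x := by
  have hmem : x - (toSl2 x : Schrodinger) ∈ heis := by
    rw [sub_eq_add_neg]
    simp [toSl2]
  have h := residual_heis hc hρ ⟨_, hmem⟩
  rw [residual, map_sub, map_sub, sub_sub_sub_comm, sub_eq_zero] at h
  exact h.symm

/-- As `𝔥` is an ideal on which the action and `Φ` agree, the residual operators commute with
`𝔥`. -/
theorem commute_residual (x : Schrodinger) (y : heis) :
    Commute (residual hc hρ x) (heisRep W y) := by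
  have hmem : ⁅x, (y : Schrodinger)⁆ ∈ heis := by
    obtain ⟨y, h0, h1, h2⟩ := y
    simp [h0, h1, h2]
  have h := residual_heis hc hρ ⟨_, hmem⟩
  have hy : oscillator (heisRep W) hc hρ y = LieModule.toEnd ℂ Schrodinger W y :=
    oscillator_heis _ hc hρ y
  rw [residual, LieHom.map_lie, LieHom.map_lie, hy, ← sub_lie,
    LieRing.of_associative_ring_bracket, sub_eq_zero] at h
  exact h

theorem residual_lie (x y : Schrodinger) :
    residual hc hρ ⁅x, y⁆ = ⁅residual hc hρ x, residual hc hρ y⁆ := by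
  have h : ∀ x y : Schrodinger, ⁅residual hc hρ x, oscillator (heisRep W) hc hρ y⁆ = 0 :=
    fun x y => by
      rw [LieRing.of_associative_ring_bracket, sub_eq_zero]
      exact commute_oscillator _ hc hρ (commute_residual hc hρ x) y
  have hd : ∀ x, LieModule.toEnd ℂ Schrodinger W x =
      residual hc hρ x + oscillator (heisRep W) hc hρ x := fun x => (sub_add_cancel _ _).symm
  have h' : ⁅oscillator (heisRep W) hc hρ x, residual hc hρ y⁆ = 0 := by
    rw [← lie_skew, h, neg_zero]
  conv_lhs => rw [residual, LieHom.map_lie, LieHom.map_lie, hd x, hd y]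
  rw [add_lie, lie_add, lie_add, h, h', add_zero, zero_add, add_sub_cancel_right]

/-- The multiplicity space of `M_𝔥(a, c)` in `W`: the eigenspace of `p` for the eigenvalue `a`. -/
noncomputable def multiplicitySpace (W : Type*) [AddCommGroup W] [Module ℂ W]
    [LieRingModule Schrodinger W] [LieModule ℂ Schrodinger W] (a : ℂ) : Submodule ℂ W :=
  Module.End.eigenspace (heisRep W pH) a

variable {a : ℂ}

theorem mem_multiplicitySpace {w : W} : w ∈ multiplicitySpace W a ↔ ⁅p, w⁆ = a • w :=
  Module.End.mem_eigenspace_iff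

theorem residual_mem_multiplicitySpace (x : Schrodinger) {w : W}
    (hw : w ∈ multiplicitySpace W a) : residual hc hρ x w ∈ multiplicitySpace W a := by
  rw [multiplicitySpace, Module.End.mem_eigenspace_iff] at hw ⊢
  rw [← Module.End.mul_apply, ← (commute_residual hc hρ x pH).eq, Module.End.mul_apply, hw,
    map_smul]

/-- The residual action of `sl₂` on the multiplicity space. -/
noncomputable def multiplicityRep (a : ℂ) :
    sl2 →ₗ⁅ℂ⁆ Module.End ℂ (multiplicitySpace W a) where
  toFun x := (residual hc hρ x).restrict fun _ hw => residual_mem_multiplicitySpace hc hρ x hw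
  map_add' x y := by
    refine LinearMap.ext fun m => Subtype.ext ?_
    change residual hc hρ ((x : Schrodinger) + y) m = residual hc hρ x m + residual hc hρ y m
    rw [residual, map_add, map_add, add_sub_add_comm]
    rfl
  map_smul' t x := by
    refine LinearMap.ext fun m => Subtype.ext ?_
    change residual hc hρ (t • (x : Schrodinger)) m = t • residual hc hρ x m
    rw [residual, map_smul, map_smul, ← smul_sub]
    rfl
  map_lie' := by
    intro x y
    refine LinearMap.ext fun m => Subtype.ext ?_
    exact LinearMap.congr_fun (residual_lie hc hρ x y) m

theorem heisRep_multiplicitySpace (hρ : heisRep W zH = c • 1) (m : multiplicitySpace W a) (x : heisPlus) :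
    heisRep W (x : heis) (m : W) = heisChar a c x • (m : W) := by
  have h4 : ((x : heis) : Schrodinger) 4 = 0 := x.2
  have hx : heisChar a c x = a * ((x : heis) : Schrodinger) 3 + c * ((x : heis) : Schrodinger) 5 :=
    rfl
  have hm : heisRep W pH m = a • (m : W) := mem_multiplicitySpace.1 m.2
  rw [heis_map_eq _ hρ, h4, hx]
  simp only [LinearMap.add_apply, LinearMap.smul_apply, hm, Module.End.one_apply]
  module

/-- For `m` in the multiplicity space, the homomorphism of `𝔥`-modules `M_𝔥(a, c) → W` with
`gen ↦ m`. -/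
noncomputable def evalMap (m : multiplicitySpace W a) : HeisWhittaker a c →ₗ[ℂ] W :=
  InducedModule.lift (heisRep W) m (heisRep_multiplicitySpace hρ m)

theorem evalMap_gen (m : multiplicitySpace W a) : evalMap hρ m (InducedModule.gen _ _) = m :=
  InducedModule.lift_gen

theorem evalMap_lie (m : multiplicitySpace W a) (x : heis) (w : HeisWhittaker a c) :
    evalMap hρ m ⁅x, w⁆ = heisRep W x (evalMap hρ m w) :=
  InducedModule.lift_lie x w

/-- Operators on `W` that commute with `𝔥` act on the maps `M_𝔥(a, c) → W` through the images of
the generator. -/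
theorem comp_evalMap {T : Module.End ℂ W} (hT : ∀ x, Commute T (heisRep W x))
    (m m' : multiplicitySpace W a) (h : T m = m') : T.comp (evalMap hρ m) = evalMap hρ m' := by
  refine InducedModule.linearMap_ext (heisRep W) (fun x w => ?_) (evalMap_lie hρ m') ?_
  · rw [LinearMap.comp_apply, evalMap_lie, ← Module.End.mul_apply, (hT x).eq]
    rfl
  · rw [LinearMap.comp_apply, evalMap_gen, evalMap_gen, h]

/-- The evaluation map as a bilinear map. -/
noncomputable def evalBilin (a : ℂ) : multiplicitySpace W a →ₗ[ℂ] HeisWhittaker a c →ₗ[ℂ] W where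
  toFun m := evalMap hρ m
  map_add' m m' := by
    refine InducedModule.linearMap_ext (heisRep W) (evalMap_lie hρ _) (fun x w => ?_) ?_
    · rw [LinearMap.add_apply, LinearMap.add_apply, evalMap_lie, evalMap_lie, map_add]
    · rw [LinearMap.add_apply, evalMap_gen, evalMap_gen, evalMap_gen]
      rfl
  map_smul' t m := by
    refine InducedModule.linearMap_ext (heisRep W) (evalMap_lie hρ _) (fun x w => ?_) ?_
    · rw [RingHom.id_apply, LinearMap.smul_apply, LinearMap.smul_apply, evalMap_lie, map_smul]
    · rw [RingHom.id_apply, LinearMap.smul_apply, evalMap_gen, evalMap_gen]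
      rfl

/-- The multiplicity space as an `sl₂`-module, through the residual action. -/
def MultiplicityModule (_ : c ≠ 0) (_ : heisRep W zH = c • 1) (a : ℂ) : Type _ :=
  multiplicitySpace W a

namespace MultiplicityModule

noncomputable instance : AddCommGroup (MultiplicityModule hc hρ a) :=
  inferInstanceAs (AddCommGroup (multiplicitySpace W a))

noncomputable instance : Module ℂ (MultiplicityModule hc hρ a) :=
  inferInstanceAs (Module ℂ (multiplicitySpace W a))

noncomputable instance : LieRingModule sl2 (MultiplicityModule hc hρ a) :=
  LieRingModule.compLieHom (multiplicitySpace W a) (multiplicityRep hc hρ a)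

instance : LieModule ℂ sl2 (MultiplicityModule hc hρ a) :=
  LieModule.compLieHom (multiplicitySpace W a) (multiplicityRep hc hρ a)

/-- The inclusion of the multiplicity module into `W`. -/
noncomputable def incl (a : ℂ) : MultiplicityModule hc hρ a →ₗ[ℂ] W :=
  (multiplicitySpace W a).subtype

theorem incl_injective : Function.Injective (incl hc hρ a) := Subtype.val_injective

theorem incl_lie (x : sl2) (m : MultiplicityModule hc hρ a) :
    incl hc hρ a ⁅x, m⁆ = residual hc hρ x (incl hc hρ a m) := rfl

/-- The evaluation map, as a bilinear map on the multiplicity module. -/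
noncomputable def eval (a : ℂ) :
    MultiplicityModule hc hρ a →ₗ[ℂ] HeisWhittaker a c →ₗ[ℂ] W :=
  evalBilin hρ a

theorem eval_gen (m : MultiplicityModule hc hρ a) :
    eval hc hρ a m (InducedModule.gen _ _) = incl hc hρ a m :=
  evalMap_gen hρ m

theorem eval_oscillator (m : MultiplicityModule hc hρ a) (x : Schrodinger)
    (w : HeisWhittaker a c) :
    eval hc hρ a m (oscillator (LieModule.toEnd ℂ heis (HeisWhittaker a c)) hc toEnd_zH x w) =
      oscillator (heisRep W) hc hρ x (eval hc hρ a m w) :=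
  oscillator_intertwine _ _ hc _ _ _ (evalMap_lie hρ m) x w

theorem eval_lie (m : MultiplicityModule hc hρ a) (x : sl2) (w : HeisWhittaker a c) :
    eval hc hρ a ⁅x, m⁆ w = residual hc hρ x (eval hc hρ a m w) :=
  (LinearMap.congr_fun (comp_evalMap hρ (commute_residual hc hρ x) m _ rfl) w).symm

/-- The homomorphism of `𝔖`-modules `M_𝔥^𝔖(a, c) ⊗ M^𝔖 → W`, `u gen ⊗ m ↦ u m`, where `M` is the
multiplicity module. -/
noncomputable def evalHom (a : ℂ) :
    HeisWhittakerS a c hc ⊗[ℂ] Sl2Inflation (MultiplicityModule hc hρ a) →ₗ⁅ℂ,Schrodinger⁆ W where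
  toLinearMap := TensorProduct.lift ((eval hc hρ a).flip.compl₁₂
    (HeisWhittakerS.of hc).symm.toLinearMap (Sl2Inflation.of _).symm.toLinearMap)
  map_lie' := by
    intro x t
    simp only [AddHom.toFun_eq_coe, LinearMap.coe_toAddHom]
    induction t using pureTensor_induction hc with
    | zero => rw [lie_zero, map_zero, lie_zero]
    | tmul w m =>
      rw [lie_pureTensor, map_add, lie_eq_oscillator_add_residual hc hρ, ← residual_toSl2]
      exact congrArg₂ (· + ·) (eval_oscillator hc hρ m x w) (eval_lie hc hρ m (toSl2 x) w)
    | add t₁ t₂ h₁ h₂ => rw [lie_add, map_add, map_add, h₁, h₂, lie_add]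

theorem evalHom_pureTensor_gen (m : MultiplicityModule hc hρ a) :
    evalHom hc hρ a (pureTensor hc _ (InducedModule.gen _ _) m) = incl hc hρ a m :=
  eval_gen hc hρ m

/-- A nonzero kernel would contain some `gen ⊗ m` with `m ≠ 0`, which is mapped to `m`. -/
theorem evalHom_injective : Function.Injective (evalHom hc hρ a) := by
  rw [← LieModuleHom.ker_eq_bot]
  refine eq_bot_of_sl2Section_eq_bot hc _ (le_bot_iff.1 fun m hm => ?_)
  rw [mem_sl2Section, LieModuleHom.mem_ker, evalHom_pureTensor_gen] at hm
  exact (LieSubmodule.mem_bot _).2 (incl_injective hc hρ (hm.trans (map_zero _).symm))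

theorem evalHom_surjective {v : W} (hv : LieSubmodule.lieSpan ℂ Schrodinger {v} = ⊤)
    (hp : ⁅p, v⁆ = a • v) : Function.Surjective (evalHom hc hρ a) := by
  rw [← LieModuleHom.range_eq_top]
  let m : MultiplicityModule hc hρ a := ⟨v, mem_multiplicitySpace.2 hp⟩
  exact LieSubmodule.eq_top_of_mem_of_lieSpan_eq_top hv _
    ((LieModuleHom.mem_range _ _).2 ⟨_, evalHom_pureTensor_gen hc hρ m⟩)

end MultiplicityModule

end Decomposition

/-- A Whittaker module `W` for the Schrödinger algebra on which `z` acts as `c ≠ 0` is the tensor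
product of `M_𝔥^𝔖` and a Whittaker module for `sl₂`, simple or not. -/
theorem exists_equiv_tensor {φ : LieAlgebra.LieCharacter ℂ nPlus} {b a c : ℂ} (he : φ eN = b)
    (hp : φ pN = a) (hc : c ≠ 0) (W : Type u) [AddCommGroup W] [Module ℂ W]
    [LieRingModule Schrodinger W] [LieModule ℂ Schrodinger W] (hW : IsWhittakerModule nPlus φ W)
    (hlevel : ∀ w : W, ⁅z, w⁆ = c • w) :
    ∃ (M : Type u) (_ : AddCommGroup M) (_ : Module ℂ M) (_ : LieRingModule sl2 M)
      (_ : LieModule ℂ sl2 M),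
      IsWhittakerModule sl2Plus (sl2Char (b - 1 / (2 * c) * a ^ 2)) M ∧
      Nonempty (W ≃ₗ⁅ℂ,Schrodinger⁆ HeisWhittakerS a c hc ⊗[ℂ] Sl2Inflation M) := by
  obtain ⟨v, ⟨hv0, hv⟩, hcyc⟩ := hW
  have hev : ⁅e, v⁆ = b • v := by rw [← he]; exact hv eN
  have hpv : ⁅p, v⁆ = a • v := by rw [← hp]; exact hv pN
  have hρ : heisRep W zH = c • 1 := LinearMap.ext hlevel
  let E := LinearEquiv.ofBijective (MultiplicityModule.evalHom hc hρ a).toLinearMap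
    ⟨MultiplicityModule.evalHom_injective hc hρ, MultiplicityModule.evalHom_surjective hc hρ hcyc hpv⟩
  let E' : HeisWhittakerS a c hc ⊗[ℂ] Sl2Inflation (MultiplicityModule hc hρ a)
      ≃ₗ⁅ℂ,Schrodinger⁆ W :=
    { MultiplicityModule.evalHom hc hρ a, E with }
  let m : MultiplicityModule hc hρ a := ⟨v, mem_multiplicitySpace.2 hpv⟩
  refine ⟨MultiplicityModule hc hρ a, inferInstance, inferInstance, inferInstance, inferInstance,
    ⟨m, (isWhittakerVector_sl2_iff m).2 ⟨fun h0 => hv0 ?_, ?_⟩, ?_⟩, ⟨E'.symm⟩⟩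
  · exact congrArg (MultiplicityModule.incl hc hρ a) h0
  · apply MultiplicityModule.incl_injective hc hρ
    rw [MultiplicityModule.incl_lie, map_smul, residual, oscillator_apply]
    change ⁅e, v⁆ - _ = _ • v
    have hpv' : heisRep W pH v = a • v := hpv
    have he2 : (e2 : Schrodinger) = e := rfl
    have hm : MultiplicityModule.incl hc hρ a m = v := rfl
    rw [hev, he2, hm]
    simp only [e, mk_apply, Matrix.cons_val, zero_smul, add_zero, one_smul, LinearMap.smul_apply,
      pow_two, Module.End.mul_apply, hpv', map_smul]
    match_scalars
    field_simp
  · refine lieSpan_eq_top_of_pureTensor_gen (a := a) hc ?_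
    set N := LieSubmodule.lieSpan ℂ Schrodinger
      {pureTensor hc _ (InducedModule.gen heisPlus (heisChar a c)) m} with hN
    have hmap : N.map (MultiplicityModule.evalHom hc hρ a) = ⊤ :=
      LieSubmodule.eq_top_of_mem_of_lieSpan_eq_top hcyc _ ((LieSubmodule.mem_map _).2
        ⟨_, LieSubmodule.subset_lieSpan (Set.mem_singleton _),
          MultiplicityModule.evalHom_pureTensor_gen hc hρ m⟩)
    rw [eq_top_iff]
    intro t _
    obtain ⟨t', ht', h⟩ := (LieSubmodule.mem_map _).1
      (hmap ▸ LieSubmodule.mem_top (MultiplicityModule.evalHom hc hρ a t))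
    rwa [← MultiplicityModule.evalHom_injective hc hρ h]

end Schrodinger

/-! ### Classification of the simple Whittaker modules -/

theorem theorem4p10 (φ : LieAlgebra.LieCharacter ℂ Schrodinger.nPlus) (eDot pDot zDot : ℂ)
    (he : φ Schrodinger.eN = eDot) (hp : φ Schrodinger.pN = pDot) (hz : zDot ≠ 0)
    (W : Type u) [AddCommGroup W] [Module ℂ W] [LieRingModule Schrodinger W]
    [LieModule ℂ Schrodinger W]
    (hW : IsWhittakerModule Schrodinger.nPlus φ W)
    (hlevel : ∀ w : W, ⁅Schrodinger.z, w⁆ = zDot • w) :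
    (IsWhittakerModule Schrodinger.heisPlus (Schrodinger.heisChar pDot zDot)
        (Schrodinger.HeisWhittaker pDot zDot) ∧
      LieModule.IsIrreducible ℂ Schrodinger.heis (Schrodinger.HeisWhittaker pDot zDot)) ∧
    (LieModule.IsIrreducible ℂ Schrodinger W ↔
      ∃ (M : Type u) (_ : AddCommGroup M) (_ : Module ℂ M) (_ : LieRingModule Schrodinger.sl2 M)
        (_ : LieModule ℂ Schrodinger.sl2 M) (Ω : ℂ),
        IsWhittakerModule Schrodinger.sl2Plus
          (Schrodinger.sl2Char (eDot - 1 / (2 * zDot) * pDot ^ 2)) M ∧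
        LieModule.IsIrreducible ℂ Schrodinger.sl2 M ∧
        (∀ m : M, uAct Schrodinger.sl2 M Schrodinger.casimir m = Ω • m) ∧
        Nonempty (W ≃ₗ⁅ℂ,Schrodinger⁆
          Schrodinger.HeisWhittakerS pDot zDot hz ⊗[ℂ] Schrodinger.Sl2Inflation M)) ∧
    (eDot - 1 / (2 * zDot) * pDot ^ 2 ≠ 0 →
      (∀ Ω : ℂ,
        IsWhittakerModule Schrodinger.sl2Plus
          (Schrodinger.sl2Char (eDot - 1 / (2 * zDot) * pDot ^ 2))
          (Schrodinger.sl2Whittaker (eDot - 1 / (2 * zDot) * pDot ^ 2) Ω) ∧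
        LieModule.IsIrreducible ℂ Schrodinger.sl2
          (Schrodinger.sl2Whittaker (eDot - 1 / (2 * zDot) * pDot ^ 2) Ω)) ∧
      (LieModule.IsIrreducible ℂ Schrodinger W ↔
        ∃ Ω : ℂ, Nonempty (W ≃ₗ⁅ℂ,Schrodinger⁆
          Schrodinger.HeisWhittakerS pDot zDot hz ⊗[ℂ] Schrodinger.Sl2Inflation
            (Schrodinger.sl2Whittaker (eDot - 1 / (2 * zDot) * pDot ^ 2) Ω)))) := by
  obtain ⟨M, _, _, _, _, hM, ⟨E⟩⟩ := Schrodinger.exists_equiv_tensor he hp hz W hW hlevel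
  have hirr : LieModule.IsIrreducible ℂ Schrodinger W ↔
      LieModule.IsIrreducible ℂ Schrodinger.sl2 M :=
    E.isIrreducible_iff.trans (Schrodinger.isIrreducible_tensor_iff hz pDot M)
  refine ⟨⟨Schrodinger.isWhittakerModule_heisWhittaker pDot zDot,
    Schrodinger.isIrreducible_heisWhittaker pDot hz⟩, ⟨fun h => ?_, ?_⟩, fun ha =>
    ⟨fun Ω => ⟨Schrodinger.isWhittakerModule_sl2Whittaker ha Ω,
      Schrodinger.isIrreducible_sl2Whittaker ha Ω⟩, fun h => ?_, ?_⟩⟩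
  · obtain ⟨Ω, hΩ⟩ := Schrodinger.exists_casimir_eq_smul (hirr.1 h)
    exact ⟨M, _, _, _, _, Ω, hM, hirr.1 h, hΩ, ⟨E⟩⟩
  · rintro ⟨M', _, _, _, _, Ω, -, hM', -, ⟨E'⟩⟩
    exact (E'.isIrreducible_iff.trans (Schrodinger.isIrreducible_tensor_iff hz pDot M')).2 hM'
  · obtain ⟨Ω, hΩ⟩ := Schrodinger.exists_casimir_eq_smul (hirr.1 h)
    obtain ⟨E₁⟩ := Schrodinger.nonempty_equiv_sl2Whittaker ha hM hΩ
    exact ⟨Ω, ⟨E.trans (Schrodinger.tensorCongr hz E₁)⟩⟩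
  · rintro ⟨Ω, ⟨E'⟩⟩
    exact (E'.isIrreducible_iff.trans (Schrodinger.isIrreducible_tensor_iff hz pDot _)).2
      (Schrodinger.isIrreducible_sl2Whittaker ha Ω)
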